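/- Let $\mathbb{F}\in\{\mathbb{R},\mathbb{C},\mathbb{H}\}$, $m=\dim_{\mathbb{R}}\mathbb{F}$, $n\ge 3$ and $p=\lfloor (n-1)/2\rfloor$. Let $E(n,\mathbb{F})$ be the real vector space of $n\times n$ matrices $A$ over $\mathbb{F}$ with $A^*=A$ and $\operatorname{tr}A=0$, with the inner product $\langle A,B\rangle=\operatorname{Re}\operatorname{tr}(AB^*)$; its dimension is $N=\tfrac12 n(n-1)m+n-1$. Let $S(n,\mathbb{F})$ be the unit sphere of $E(n,\mathbb{F})$, let $f_k(A)=\operatorname{tr}A^k$ for $A\in S(n,\mathbb{F})$, and let $$\Phi=(f_3,f_5,\dots,f_{2p+1}):S(n,\mathbb{F})\to\mathbb{R}^p .$$ Let $\mathcal{B}_{n,\mathbb{F}}$ be the set of those $A\in\Phi^{-1}(0)$ that are regular points of $\Phi$, i.e. at which the differential $d\Phi_A:T_AS(n,\mathbb{F})\to\mathbb{R}^p$ is surjective. Then: 1. $\mathcal{B}_{n,\mathbb{F}}$ is a smooth embedded (not necessarily closed) submanifold of $S(n,\mathbb{F})$, of dimension $N-p-1$. 2. $\mathcal{B}_{n,\mathbb{F}}$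 is austere in $S(n,\mathbb{F})$: for every normal vector, the principal curvatures (the eigenvalues of the shape operator, counted with multiplicity) are invariant under multiplication by $-1$, i.e. of the form $\lambda_1,-\lambda_1,\dots,\lambda_q,-\lambda_q,0,\dots,0$. 3. The normal bundle of $\mathcal{B}_{n,\mathbb{F}}$ in $S(n,\mathbb{F})$ is flat: the curvature of the normal connection vanishes identically. 4. The gradients on $S(n,\mathbb{F})$ of $f_3,f_5,\dots,f_{2p+1}$, restricted to $\mathcal{B}_{n,\mathbb{F}}$, form a global smooth frame of this normal bundle; in particular the normal bundle is trivial. 5. At each point $A\in\mathcal{B}_{n,\mathbb{F}}$, the shape operators in the normal directions $\operatorname{grad}f_{2\alpha+1}$, $1\le\alpha\le p$, are simultaneously diagonalizable in an orthonormal basis of $T_A\mathcal{B}_{n,\mathbb{F}}$, and the eigenvalues of each of them, counted with multiplicity, are invariant under multiplication by $-1$. -/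

import Mathlib

open scoped ContDiff Topology Quaternion Matrix InnerProductSpace

noncomputable section

namespace SubmanifoldGeometry

/-! ### Submanifolds of a Euclidean space and their extrinsic geometry

`V` is a finite-dimensional real inner product space.  A submanifold of `V` is a subset `M`, and it
carries the induced metric.  For `M ⊆ N ⊆ V` we study the geometry of `M` as a submanifold of the
Riemannian manifold `N`.  Maps and vector fields on `M` are represented by maps defined on `V`, of
which only the values on `M` are used: they are differentiated within `M`, in directions that are
tangent to `M`. -/

variable {V : Type*} [NormedAddCommGroup V] [InnerProductSpace ℝ V]
  {W : Type*} [NormedAddCommGroup W] [NormedSpace ℝ W]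

/-- `M` is a (smooth, embedded, not necessarily closed) `d`-dimensional submanifold of `V`: around
each of its points a diffeomorphism between open sets of `V` flattens `M` to a `d`-dimensional
linear subspace. -/
def IsSubmanifold (M : Set V) (d : ℕ) : Prop :=
  ∀ x ∈ M, ∃ (φ : OpenPartialHomeomorph V V) (L : Submodule ℝ V),
    x ∈ φ.source ∧ ContDiffOn ℝ ∞ φ φ.source ∧ ContDiffOn ℝ ∞ φ.symm φ.target ∧
      Module.finrank ℝ L = d ∧ ∀ y ∈ φ.source, y ∈ M ↔ φ y ∈ L

/-- The tangent space of `M` at `x`: the span of the velocities at `x` of smooth curves in `M`. -/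
def tangentSpace (M : Set V) (x : V) : Submodule ℝ V :=
  Submodule.span ℝ {v | ∃ (γ : ℝ → V) (ε : ℝ), 0 < ε ∧ ContDiffOn ℝ ∞ γ (Set.Ioo (-ε) ε) ∧
    (∀ t ∈ Set.Ioo (-ε) ε, γ t ∈ M) ∧ γ 0 = x ∧ HasDerivAt γ v 0}

/-- The differential `T_x N → W` at `x` of the restriction of `f` to `N`. -/
def differential (N : Set V) (f : V → W) (x : V) : tangentSpace N x →ₗ[ℝ] W :=
  (fderivWithin ℝ f N x).toLinearMap.domRestrict (tangentSpace N x)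

variable [FiniteDimensional ℝ V]

/-- The gradient at `x` of the restriction of `f` to the Riemannian manifold `N`: the vector of
`T_x N` that represents the differential of `f`. -/
def grad (N : Set V) (f : V → ℝ) (x : V) : V :=
  ((InnerProductSpace.toDual ℝ (tangentSpace N x)).symm
    (LinearMap.toContinuousLinearMap (differential N f x)) : tangentSpace N x)

/-- The normal space at `x` of `M` in `N`. -/
def normalSpace (N M : Set V) (x : V) : Submodule ℝ V :=
  tangentSpace N x ⊓ (tangentSpace M x)ᗮ

/-- Smooth vector fields on `M` tangent to `M`. -/
def IsTangentField (M : Set V) (X : V → V) : Prop :=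
  ContDiffOn ℝ ∞ X M ∧ ∀ x ∈ M, X x ∈ tangentSpace M x

/-- Smooth sections of the normal bundle of `M` in `N`. -/
def IsNormalField (N M : Set V) (ν : V → V) : Prop :=
  ContDiffOn ℝ ∞ ν M ∧ ∀ x ∈ M, ν x ∈ normalSpace N M x

/-- The Levi-Civita covariant derivative of `N`, applied at `x ∈ M` to a vector field `Z` along `M`
(with values tangent to `N`) in the direction `v ∈ T_x M`: the component of the Euclidean
derivative of `Z` that is tangent to `N`. -/
def covDeriv (N M : Set V) (Z : V → V) (x v : V) : V :=
  (tangentSpace N x).starProjection (fderivWithin ℝ Z M x v)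

/-- The shape operator `S_ν : T_x M → T_x M`, `v ↦ -(∇_v ν)ᵀ`, of `M` in `N` at `x` in the direction
of the normal field `ν`. -/
def shapeOperator (N M : Set V) (ν : V → V) (x : V) : tangentSpace M x →ₗ[ℝ] tangentSpace M x :=
  -((tangentSpace M x).orthogonalProjectionOnto.toLinearMap ∘ₗ
    (tangentSpace N x).starProjection.toLinearMap ∘ₗ differential M ν x)

/-- The normal connection: `x ↦ (∇_X ν)^⊥`. -/
def normalConnection (N M : Set V) (X ν : V → V) (x : V) : V :=
  (normalSpace N M x).starProjection (covDeriv N M ν x (X x))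

/-- The normal curvature `R^⊥(X, Y) ν = ∇^⊥_X ∇^⊥_Y ν - ∇^⊥_Y ∇^⊥_X ν - ∇^⊥_[X, Y] ν`. -/
def normalCurvature (N M : Set V) (X Y ν : V → V) (x : V) : V :=
  normalConnection N M X (normalConnection N M Y ν) x
    - normalConnection N M Y (normalConnection N M X ν) x
    - normalConnection N M (VectorField.lieBracketWithin ℝ X Y M) ν x

/-- `M` has flat normal bundle in `N`: the normal connection has zero curvature. -/
def HasFlatNormalBundle (N M : Set V) : Prop :=
  ∀ X Y ν : V → V, IsTangentField M X → IsTangentField M Y → IsNormalField N M ν →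
    ∀ x ∈ M, normalCurvature N M X Y ν x = 0

/-- `ν` is a global smooth frame of the normal bundle of `M` in `N`; so this bundle is trivial. -/
def IsNormalFrame (N M : Set V) {k : ℕ} (ν : Fin k → V → V) : Prop :=
  (∀ a, IsNormalField N M (ν a)) ∧
    ∀ x ∈ M, LinearIndependent ℝ (fun a => ν a x) ∧
      Submodule.span ℝ (Set.range fun a => ν a x) = normalSpace N M x

/-- The finite family `κ` is, with multiplicities, invariant under multiplication by `-1`, that is,
it has the form `λ₁, -λ₁, …, λ_q, -λ_q, 0, …, 0` up to order. -/
def IsSignSymmetric {ι : Type*} (κ : ι → ℝ) : Prop :=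
  ∃ σ : Equiv.Perm ι, ∀ i, κ (σ i) = -κ i

/-- The operators `S a` on the Euclidean space `T` are simultaneously diagonalizable in an
orthonormal basis, and the eigenvalues of each of them, with multiplicities, are invariant under
multiplication by `-1`. -/
def SimultaneouslyDiagonalizableSymmetric {T : Type*} [NormedAddCommGroup T]
    [InnerProductSpace ℝ T] {A : Type*} (S : A → T →ₗ[ℝ] T) : Prop :=
  ∃ (b : OrthonormalBasis (Fin (Module.finrank ℝ T)) ℝ T)
    (κ : A → Fin (Module.finrank ℝ T) → ℝ),
    (∀ a i, S a (b i) = κ a i • b i) ∧ ∀ a, IsSignSymmetric (κ a)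

/-- `M` is austere in `N`: in every normal direction, the principal curvatures (the eigenvalues of
the shape operator, with multiplicities) are invariant under multiplication by `-1`. -/
def IsAustere (N M : Set V) : Prop :=
  ∀ ν : V → V, IsNormalField N M ν → ∀ x ∈ M,
    ∃ (b : OrthonormalBasis (Fin (Module.finrank ℝ (tangentSpace M x))) ℝ (tangentSpace M x))
      (κ : Fin (Module.finrank ℝ (tangentSpace M x)) → ℝ),
      (∀ i, shapeOperator N M ν x (b i) = κ i • b i) ∧ IsSignSymmetric κ

end SubmanifoldGeometry

namespace HermitianMatrices

open SubmanifoldGeometry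

/-! ### Matrices over `𝔽 = ℝ, ℂ, ℍ`

`𝔽` stands for `ℝ`, `ℂ` or `ℍ`, with its usual real inner product `⟪a, b⟫ = Re (a * star b)`; in
particular `⟪1, a⟫` is the real part of `a`.  The space of `n × n` matrices carries the Euclidean
inner product `⟪A, B⟫ = Re tr (A * Bᴴ)`, whose norm is the Frobenius norm. -/

/-- The Frobenius norm on the space of matrices. -/
instance instNormedAddCommGroupMatrix (n : ℕ) (𝔽 : Type) [NormedRing 𝔽] :
    NormedAddCommGroup (Matrix (Fin n) (Fin n) 𝔽) :=
  Matrix.frobeniusNormedAddCommGroup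

theorem norm_sq_matrix (n : ℕ) (𝔽 : Type) [NormedRing 𝔽] [InnerProductSpace ℝ 𝔽]
    (A : Matrix (Fin n) (Fin n) 𝔽) : ‖A‖ ^ 2 = ∑ i, ∑ j, ⟪A i j, A i j⟫_ℝ := by
  rw [show ‖A‖ = (∑ i, ∑ j, ‖A i j‖ ^ (2 : ℝ)) ^ (1 / 2 : ℝ) from Matrix.frobenius_norm_def A]
  simp only [real_inner_self_eq_norm_sq, Real.rpow_two]
  rw [← Real.sqrt_eq_rpow, Real.sq_sqrt (by positivity)]

/-- The Euclidean inner product on the space of matrices. -/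
instance instInnerProductSpaceMatrix (n : ℕ) (𝔽 : Type) [NormedRing 𝔽] [InnerProductSpace ℝ 𝔽] :
    InnerProductSpace ℝ (Matrix (Fin n) (Fin n) 𝔽) where
  toNormedSpace := Matrix.frobeniusNormedSpace
  inner A B := ∑ i, ∑ j, ⟪A i j, B i j⟫_ℝ
  norm_sq_eq_re_inner A := by simpa using norm_sq_matrix n 𝔽 A
  conj_inner_symm A B := by simp [real_inner_comm]
  add_left A B C := by simp [inner_add_left, Finset.sum_add_distrib]
  smul_left A B r := by simp [real_inner_smul_left, Finset.mul_sum]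

theorem inner_matrix_real (n : ℕ) (A B : Matrix (Fin n) (Fin n) ℝ) :
    ⟪A, B⟫_ℝ = (A * Bᴴ).trace := by
  simp [inner, Matrix.trace, Matrix.mul_apply, mul_comm]

theorem inner_matrix_complex (n : ℕ) (A B : Matrix (Fin n) (Fin n) ℂ) :
    ⟪A, B⟫_ℝ = (A * Bᴴ).trace.re := by
  simp [inner, Matrix.trace, Matrix.mul_apply, mul_comm]

theorem inner_matrix_quaternion (n : ℕ) (A B : Matrix (Fin n) (Fin n) ℍ[ℝ]) :
    ⟪A, B⟫_ℝ = (A * Bᴴ).trace.re := by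
  have h : ∀ {ι : Type} (s : Finset ι) (f : ι → ℍ[ℝ]), (∑ i ∈ s, f i).re = ∑ i ∈ s, (f i).re :=
    fun s f => map_sum (AddMonoidHom.mk' (fun q : ℍ[ℝ] => q.re) (fun _ _ => rfl)) f s
  simp [inner, Matrix.trace, Matrix.mul_apply, h]

variable (n : ℕ) (𝔽 : Type) [NormedRing 𝔽] [InnerProductSpace ℝ 𝔽]

/-- The function `f_k : A ↦ tr A ^ k`, as a real number: the trace of a power of a Hermitian matrix
is real, and here its real part is taken. -/
def f (k : ℕ) (A : Matrix (Fin n) (Fin n) 𝔽) : ℝ :=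
  ⟪1, (A ^ k).trace⟫_ℝ

/-- `Φ = (f_3, f_5, …, f_{2p+1})` where `p = ⌊(n - 1) / 2⌋`. -/
def Φ (A : Matrix (Fin n) (Fin n) 𝔽) : Fin ((n - 1) / 2) → ℝ :=
  fun a => f n 𝔽 (2 * a + 3) A

/-- The dimension `N(n, 𝔽)` of the space of traceless Hermitian matrices. -/
def dimE : ℕ :=
  n * (n - 1) / 2 * Module.finrank ℝ 𝔽 + (n - 1)

variable [StarRing 𝔽]

/-- `S(n, 𝔽)`: the unit sphere in the space `E(n, 𝔽)` of traceless Hermitian matrices. -/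
def S : Set (Matrix (Fin n) (Fin n) 𝔽) :=
  {A | A.IsHermitian ∧ A.trace = 0 ∧ ‖A‖ = 1}

/-- `B_{n, 𝔽}`: the regular points of `Φ : S(n, 𝔽) → ℝ^p` in `Φ⁻¹(0)`. -/
def B : Set (Matrix (Fin n) (Fin n) 𝔽) :=
  {A | A ∈ S n 𝔽 ∧ Φ n 𝔽 A = 0 ∧ Function.Surjective (differential (S n 𝔽) (Φ n 𝔽) A)}

variable [FiniteDimensional ℝ 𝔽]

/-- The vector fields `grad f_3, grad f_5, …, grad f_{2p+1}`, gradients on the sphere `S(n, 𝔽)`. -/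
def gradField (a : Fin ((n - 1) / 2)) (A : Matrix (Fin n) (Fin n) 𝔽) :
    Matrix (Fin n) (Fin n) 𝔽 :=
  grad (S n 𝔽) (f n 𝔽 (2 * a + 3)) A

end HermitianMatrices

end

/-!
The argument is the same over `ℝ`, `ℂ` and `ℍ`; it uses only the properties collected in
`IsEuclideanStarRing`.

Both `S` and `B` are regular level sets, of `sphereMap` and of `sphereMap` together with `Φ`
(`S_eq_regularZeros`, `B_eq_regularZeros`). This yields flattening charts, the dimension, and the
tangent spaces (`exists_flattening`, `mem_tangentSpace_regularZeros`), and the gradients of the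
components of `Φ` form a normal frame (`isNormalFrame_grad`). At `A ∈ B` the gradient of `f_k` is the
traceless part of `k • A ^ (k - 1)`, so its shape operator is, up to the factor `-k`, the tangential
part of the operator `powDeriv (k - 1) A`, `X ↦ ∑ A ^ i * X * A ^ (k - 2 - i)`.

On `B` the odd power sums of the eigenvalues vanish up to the exponent `n`. By Newton's identities
the spectrum of `A` is symmetric (`isSignSymmetric_of_sum_odd_pow`), and with the spectral theorem
over `𝔽` (`exists_unitary_diagonalization`) this has two consequences, stated in
`exists_unitary_conj_eq_neg`.

* There is a unitary `R` with `R * A * Rᴴ = -A`. Conjugation by `R` preserves the tangent space, and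
  it anticommutes with the shape operators, as `k - 1` is even (`exists_anticommuting_equiv`). So the
  shape operators have symmetric spectra (`isSignSymmetric_of_anticommute`). Those of arbitrary normal
  fields are combinations of those of the frame (`exists_shapeOperator_eq_sum`).
* The even powers of `A` are combinations of `1, A ^ 2, …, A ^ (2 * p)`. Hence a tangent vector is
  the sum of an odd polynomial in `A`, which `powDeriv (k - 1) A` maps to even powers of `A` and so to
  normal vectors, and of a vector orthogonal to all powers of `A`. On vectors of the latter kind the
  shape operators are multiples of the operators `powDeriv (k - 1) A`, and these commute. So the
  shape operators commute (`commute_shapeOperator_gradField`).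

Commuting symmetric operators are simultaneously diagonalizable, and by the Ricci equation
(`inner_normalCurvature`) the normal curvature is given by their commutators, so it vanishes.
-/

open scoped ContDiff Topology Quaternion Matrix InnerProductSpace

/-! ### Regular level sets -/

namespace SubmanifoldGeometry

section LevelSets

variable {V : Type*} [NormedAddCommGroup V] [InnerProductSpace ℝ V]
  {W : Type*} [NormedAddCommGroup W] [NormedSpace ℝ W]

/-- On a set without unique derivatives `fderivWithin` is an arbitrary derivative, but on tangent
vectors, the velocities of curves in the set, all derivatives agree. -/
theorem fderivWithin_apply_of_mem_tangentSpace {M : Set V} {f : V → W} {f' : V →L[ℝ] W} {x v : V}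
    (hf : HasFDerivWithinAt f f' M x) (hv : v ∈ tangentSpace M x) :
    fderivWithin ℝ f M x v = f' v := by
  have hd := hf.differentiableWithinAt.hasFDerivWithinAt
  refine Submodule.span_induction ?_ (by simp) (fun a b _ _ ha hb => by simp [ha, hb])
    (fun c a _ ha => by simp [ha]) hv
  rintro v ⟨γ, ε, hε, -, hM, rfl, hγ⟩
  have key : ∀ g : V →L[ℝ] W, HasFDerivWithinAt f g M (γ 0) → HasDerivAt (f ∘ γ) (g v) 0 := by
    intro g hg
    have h := hg.comp_hasDerivWithinAt 0 (hγ.hasDerivWithinAt (s := Set.Ioo (-ε) ε)) hM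
    exact h.hasDerivAt (Ioo_mem_nhds (by linarith) hε)
  exact (key _ hd).unique (key _ hf)

theorem differential_apply {N : Set V} {f : V → W} {f' : V →L[ℝ] W} {x : V}
    (hf : HasFDerivWithinAt f f' N x) (v : tangentSpace N x) : differential N f x v = f' v :=
  fderivWithin_apply_of_mem_tangentSpace hf v.2

/-- The set of the zeros of `h` that are regular points of `h`. -/
def regularZeros (h : V → W) : Set V :=
  {x | h x = 0 ∧ Function.Surjective (fderiv ℝ h x)}

variable [FiniteDimensional ℝ V] [FiniteDimensional ℝ W]

/-- If `T` is a right inverse of the differential `h'` of `h` at `x`, then `y ↦ y + T (h y - h' y)`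
has the differential `1` at `x`, and it maps the zeros of `h`, and no other points, to the kernel
of `h'`. -/
theorem exists_flattening {h : V → W} (hh : ContDiff ℝ ∞ h) {x : V} (hx : x ∈ regularZeros h) :
    ∃ φ : OpenPartialHomeomorph V V, x ∈ φ.source ∧ ContDiffOn ℝ ∞ φ φ.source ∧
      ContDiffOn ℝ ∞ φ.symm φ.target ∧ HasFDerivAt φ (ContinuousLinearMap.id ℝ V) x ∧
      ∀ y ∈ φ.source, y ∈ regularZeros h ↔ φ y ∈ LinearMap.ker (fderiv ℝ h x).toLinearMap := by
  set h' := fderiv ℝ h x with hh'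
  obtain ⟨T₀, hT₀⟩ := LinearMap.exists_rightInverse_of_surjective h'.toLinearMap
    (LinearMap.range_eq_top.2 hx.2)
  set T : W →L[ℝ] V := LinearMap.toContinuousLinearMap T₀ with hT
  have hT' : ∀ w, h' (T w) = w := fun w => LinearMap.congr_fun hT₀ w
  let G : V → V := fun y => y + T (h y - h' y)
  have hG : ContDiff ℝ ∞ G := by fun_prop
  have hGd : ∀ y, HasFDerivAt G (ContinuousLinearMap.id ℝ V + T ∘L (fderiv ℝ h y - h')) y := by
    intro y
    have h1 : HasFDerivAt h (fderiv ℝ h y) y := (hh.differentiable (by simp) y).hasFDerivAt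
    exact (hasFDerivAt_id y).add (T.hasFDerivAt.comp y (h1.sub h'.hasFDerivAt))
  have hGx : HasFDerivAt G ((ContinuousLinearEquiv.refl ℝ V : V ≃L[ℝ] V) : V →L[ℝ] V) x := by
    convert hGd x using 1
    ext v
    simp [hh']
  let φ₀ := hG.contDiffAt.toOpenPartialHomeomorph G hGx (by simp)
  have hφ₀ : (φ₀ : V → V) = G := rfl
  let O : Set V := (fun y => fderiv ℝ G y) ⁻¹' Set.range ((↑) : (V ≃L[ℝ] V) → V →L[ℝ] V)
  have hO : IsOpen O :=
    ContinuousLinearEquiv.isOpen.preimage (hG.continuous_fderiv (by simp))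
  let φ := φ₀.restrOpen O hO
  have hφ : (φ : V → V) = G := rfl
  have hsrc : φ.source = φ₀.source ∩ O := rfl
  refine ⟨φ, ?_, ?_, ?_, ?_, ?_⟩
  · rw [hsrc]
    exact ⟨hG.contDiffAt.mem_toOpenPartialHomeomorph_source hGx (by simp),
      ⟨ContinuousLinearEquiv.refl ℝ V, hGx.fderiv.symm⟩⟩
  · exact hG.contDiffOn
  · intro z hz
    have hz' := φ.map_target hz
    obtain ⟨e, he⟩ := (hsrc ▸ hz').2
    refine (φ.contDiffAt_symm (f₀' := e) hz ?_ hG.contDiffAt).contDiffWithinAt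
    rw [he]
    exact (hG.differentiable (by simp) _).hasFDerivAt
  · exact hGx
  · intro y hy
    obtain ⟨e, he⟩ := (hsrc ▸ hy).2
    have hker : h' (G y) = h y := by simp [G, hT']
    have hreg : Function.Surjective (fderiv ℝ h y) := by
      intro w
      obtain ⟨u, hu⟩ := e.surjective (T w)
      refine ⟨u, ?_⟩
      have h2 : fderiv ℝ G y u = T w := by
        have he' : (e : V →L[ℝ] V) = fderiv ℝ G y := he
        rw [← he']; exact hu
      rw [(hGd y).fderiv] at h2
      have h3 := congrArg h' h2
      simpa [hT'] using h3
    rw [hφ, LinearMap.mem_ker]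
    change _ ↔ h' (G y) = 0
    rw [hker]
    exact ⟨fun h => h.1, fun h => ⟨h, hreg⟩⟩

theorem isSubmanifold_regularZeros {h : V → W} (hh : ContDiff ℝ ∞ h) {d : ℕ}
    (hd : Module.finrank ℝ V = d + Module.finrank ℝ W) : IsSubmanifold (regularZeros h) d := by
  intro x hx
  obtain ⟨φ, h1, h2, h3, -, h4⟩ := exists_flattening hh hx
  refine ⟨φ, _, h1, h2, h3, ?_, h4⟩
  have h5 := LinearMap.finrank_range_add_finrank_ker (fderiv ℝ h x).toLinearMap
  rw [LinearMap.range_eq_top.2 hx.2, finrank_top] at h5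
  omega

theorem mem_tangentSpace_regularZeros {h : V → W} (hh : ContDiff ℝ ∞ h) {x : V}
    (hx : x ∈ regularZeros h) {v : V} :
    v ∈ tangentSpace (regularZeros h) x ↔ fderiv ℝ h x v = 0 := by
  constructor
  · intro hv
    have h1 : HasFDerivWithinAt h (fderiv ℝ h x) (regularZeros h) x :=
      (hh.differentiable (by simp) x).hasFDerivAt.hasFDerivWithinAt
    have h2 : HasFDerivWithinAt h (0 : V →L[ℝ] W) (regularZeros h) x :=
      (hasFDerivWithinAt_const (0 : W) x _).congr (fun y hy => hy.1) hx.1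
    rw [← fderivWithin_apply_of_mem_tangentSpace h1 hv,
      fderivWithin_apply_of_mem_tangentSpace h2 hv]
    rfl
  · intro hv
    obtain ⟨φ, hxs, -, hsymm, hder, hφ⟩ := exists_flattening hh hx
    -- the curve that the chart straightens to the line through `φ x` in the direction `v`
    let l : ℝ → V := fun t => φ x + t • v
    have hl : Continuous l := by fun_prop
    have hl0 : l 0 = φ x := by simp [l]
    have hopen : IsOpen (l ⁻¹' φ.target) := φ.open_target.preimage hl
    have h0 : (0 : ℝ) ∈ l ⁻¹' φ.target := by
      rw [Set.mem_preimage, hl0]; exact φ.map_source hxs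
    obtain ⟨ε, hε, hball⟩ := Metric.isOpen_iff.1 hopen 0 h0
    rw [Real.ball_eq_Ioo, zero_sub, zero_add] at hball
    refine Submodule.subset_span ⟨φ.symm ∘ l, ε, hε, ?_, ?_, ?_, ?_⟩
    · refine hsymm.comp (t := φ.target) (ContDiff.contDiffOn ?_) hball
      fun_prop
    · intro t ht
      have ht' : l t ∈ φ.target := hball ht
      refine (hφ _ (φ.map_target ht')).2 ?_
      rw [φ.right_inv ht']
      exact Submodule.add_mem _ ((hφ x hxs).1 hx) (Submodule.smul_mem _ _ hv)
    · simp [hl0, φ.left_inv hxs]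
    · have hs : HasFDerivAt φ.symm
          ((ContinuousLinearEquiv.refl ℝ V).symm : V →L[ℝ] V) (l 0) := by
        refine φ.hasFDerivAt_symm h0 ?_
        rw [hl0, φ.left_inv hxs]
        exact hder
      have hld : HasDerivAt l v 0 := by
        simpa [l] using ((hasDerivAt_id (0 : ℝ)).smul_const v).const_add (φ x)
      exact hs.comp_hasDerivAt 0 hld

/-- A smooth retraction of a neighbourhood of `x` onto the part of the submanifold in it: in a
flattening chart, the orthogonal projection onto the linear subspace. -/
theorem exists_retraction {h : V → W} (hh : ContDiff ℝ ∞ h) {x : V} (hx : x ∈ regularZeros h) :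
    ∃ (U : Set V) (r : V → V), IsOpen U ∧ x ∈ U ∧ ContDiffOn ℝ ∞ r U ∧
      Set.MapsTo r U (regularZeros h) ∧ ∀ y ∈ regularZeros h ∩ U, r y = y := by
  obtain ⟨φ, hxs, hφc, hsymm, -, hφ⟩ := exists_flattening hh hx
  set K := LinearMap.ker (fderiv ℝ h x).toLinearMap
  let P : V →L[ℝ] V := K.starProjection
  have hP : ∀ y ∈ K, P y = y := fun y hy => Submodule.starProjection_eq_self_iff.2 hy
  refine ⟨φ.source ∩ φ ⁻¹' (P ⁻¹' φ.target), φ.symm ∘ P ∘ φ, ?_, ?_, ?_, ?_, ?_⟩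
  · exact φ.continuousOn.isOpen_inter_preimage φ.open_source (φ.open_target.preimage P.continuous)
  · refine ⟨hxs, ?_⟩
    rw [Set.mem_preimage, Set.mem_preimage, hP _ ((hφ x hxs).1 hx)]
    exact φ.map_source hxs
  · refine hsymm.comp (t := φ.target) ?_ (fun y hy => hy.2)
    exact P.contDiff.comp_contDiffOn (hφc.mono Set.inter_subset_left)
  · intro y hy
    have hy2 : P (φ y) ∈ φ.target := hy.2
    refine (hφ _ (φ.map_target hy2)).2 ?_
    rw [φ.right_inv hy2]
    exact Submodule.starProjection_apply_mem _ _
  · rintro y ⟨hyM, hys, -⟩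
    simp only [Function.comp_apply]
    rw [hP _ ((hφ y hys).1 hyM), φ.left_inv hys]

/-- Smooth maps on the submanifold extend to smooth maps near a given point, with the same
derivatives in tangent directions. -/
theorem exists_local_extension {h : V → W} (hh : ContDiff ℝ ∞ h) {x : V}
    (hx : x ∈ regularZeros h) :
    ∃ U : Set V, IsOpen U ∧ x ∈ U ∧ ∀ f : V → V, ContDiffOn ℝ ∞ f (regularZeros h) →
      ∃ g : V → V, ContDiffOn ℝ ∞ g U ∧ ∀ y ∈ regularZeros h ∩ U, g y = f y ∧
        HasFDerivWithinAt f (fderiv ℝ g y) (regularZeros h) y := by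
  obtain ⟨U, r, hU, hxU, hr, hmap, hid⟩ := exists_retraction hh hx
  refine ⟨U, hU, hxU, fun f hf => ⟨f ∘ r, hf.comp hr hmap, fun y hy => ?_⟩⟩
  have hy1 : (f ∘ r) y = f y := by rw [Function.comp_apply, hid y hy]
  refine ⟨hy1, ?_⟩
  have hg : HasFDerivAt (f ∘ r) (fderiv ℝ (f ∘ r) y) y :=
    (((hf.comp hr hmap).contDiffAt (hU.mem_nhds hy.2)).differentiableAt (by simp)).hasFDerivAt
  refine (hg.hasFDerivWithinAt (s := regularZeros h)).congr_of_eventuallyEq ?_ hy1.symm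
  filter_upwards [self_mem_nhdsWithin, mem_nhdsWithin_of_mem_nhds (hU.mem_nhds hy.2)] with z hz hzU
  rw [Function.comp_apply, hid z ⟨hz, hzU⟩]

end LevelSets

end SubmanifoldGeometry

/-! ### Symmetric spectra and joint diagonalization -/

namespace SubmanifoldGeometry

section Spectra

variable {T : Type*} [NormedAddCommGroup T] [InnerProductSpace ℝ T] [FiniteDimensional ℝ T]

theorem isSignSymmetric_of_map_eq {ι : Type*} [Fintype ι] {κ : ι → ℝ}
    (h : Finset.univ.val.map κ = Finset.univ.val.map (fun i => -κ i)) : IsSignSymmetric κ := by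
  classical
  have hc : ∀ r : ℝ, Fintype.card {i // κ i = r} = Fintype.card {i // -κ i = r} := by
    intro r
    have h1 := congrArg (Multiset.count r) h
    rw [Multiset.count_map, Multiset.count_map] at h1
    rw [Fintype.card_subtype, Fintype.card_subtype]
    simpa [Finset.card_def, Finset.filter_val, eq_comm] using h1
  -- match the fibres of `-κ` with those of `κ`
  let e : ι ≃ ι := (Equiv.sigmaFiberEquiv (fun i => -κ i)).symm.trans
    ((Equiv.sigmaCongrRight fun r => Fintype.equivOfCardEq (hc r).symm).trans
      (Equiv.sigmaFiberEquiv κ))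
  refine ⟨e, fun i => ?_⟩
  exact (Fintype.equivOfCardEq (hc (-κ i)).symm ⟨i, rfl⟩).2

/-- An operator that is conjugate to its negative has a symmetric spectrum: its characteristic
polynomial is that of its negative. -/
theorem isSignSymmetric_of_anticommute {ι : Type*} [Fintype ι] {S : T →ₗ[ℝ] T} (J : T ≃ₗ[ℝ] T)
    (hJ : ∀ v, J (S v) = -S (J v)) (b : Module.Basis ι ℝ T) {κ : ι → ℝ}
    (hκ : ∀ i, S (b i) = κ i • b i) : IsSignSymmetric κ := by
  classical
  have hS : J.conj S = -S := by
    ext v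
    simp [LinearEquiv.conj_apply, hJ]
  have hm : ∀ (R : T →ₗ[ℝ] T) (μ : ι → ℝ), (∀ i, R (b i) = μ i • b i) →
      R.charpoly.roots = Finset.univ.val.map μ := by
    intro R μ hR
    have h1 : LinearMap.toMatrix b b R = Matrix.diagonal μ := by
      ext i j
      rw [LinearMap.toMatrix_apply, hR]
      by_cases hij : i = j
      · subst hij; simp
      · simp [hij]
    rw [← LinearMap.charpoly_toMatrix R b, h1, Matrix.charpoly_diagonal,
      ← Polynomial.roots_multiset_prod_X_sub_C (Finset.univ.val.map μ), Multiset.map_map]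
    rfl
  have h2 : S.charpoly = (-S).charpoly := by
    rw [← hS, LinearEquiv.charpoly_conj]
  apply isSignSymmetric_of_map_eq
  rw [← hm S κ hκ, h2]
  exact hm (-S) _ fun i => by simp [hκ]

theorem exists_orthonormalBasis_joint_eigenvectors {A : Type*} {S : A → T →ₗ[ℝ] T}
    (hS : ∀ a, (S a).IsSymmetric) (hc : ∀ a b, Commute (S a) (S b)) :
    ∃ (b : OrthonormalBasis (Fin (Module.finrank ℝ T)) ℝ T)
      (κ : A → Fin (Module.finrank ℝ T) → ℝ), ∀ a i, S a (b i) = κ a i • b i := by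
  classical
  have hint := LinearMap.IsSymmetric.directSum_isInternal_of_pairwise_commute hS
    (fun a b _ => hc a b)
  have hort := LinearMap.IsSymmetric.orthogonalFamily_iInf_eigenspaces hS
  set E : (A → ℝ) → Submodule ℝ T := fun χ => ⨅ a, Module.End.eigenspace (S a) (χ a) with hE
  have hfin : Finite {χ // E χ ≠ ⊥} :=
    WellFoundedGT.finite_ne_bot_of_iSupIndep hint.submodule_iSupIndep
  have := Fintype.ofFinite {χ // E χ ≠ ⊥}
  have hint' := (DirectSum.isInternal_ne_bot_iff (A := E)).2 hint
  have hort' : OrthogonalFamily ℝ (fun χ : {χ // E χ ≠ ⊥} => E χ) fun χ => (E χ).subtypeₗᵢ :=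
    hort.comp Subtype.val_injective
  refine ⟨hint'.subordinateOrthonormalBasis rfl hort',
    fun a i => (hint'.subordinateOrthonormalBasisIndex rfl i hort').1 a, fun a i => ?_⟩
  have h := hint'.subordinateOrthonormalBasis_subordinate rfl i hort'
  exact Module.End.mem_eigenspace_iff.1 ((Submodule.mem_iInf _).1 h a)

end Spectra

end SubmanifoldGeometry

/-! ### Normal frames and shape operators -/

namespace SubmanifoldGeometry

section Frames

variable {V : Type*} [NormedAddCommGroup V] [InnerProductSpace ℝ V]

theorem DifferentiableWithinAt.matrix_det {k : ℕ} {G : V → Matrix (Fin k) (Fin k) ℝ} {M : Set V}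
    {x : V} (hG : ∀ a b, DifferentiableWithinAt ℝ (fun y => G y a b) M x) :
    DifferentiableWithinAt ℝ (fun y => (G y).det) M x := by
  simp only [Matrix.det_apply]
  refine DifferentiableWithinAt.fun_sum fun σ _ => ?_
  refine DifferentiableWithinAt.const_smul ?_ _
  exact (HasFDerivWithinAt.finsetProd fun i _ =>
    (hG (σ i) i).hasFDerivWithinAt).differentiableWithinAt

/-- The coefficients with respect to a differentiable frame of the orthogonal projection of a
differentiable field to the span of the frame are differentiable: by Cramer's rule they are
quotients of determinants of inner products. -/
theorem exists_differentiable_coeff {k : ℕ} {ν : Fin k → V → V} {M : Set V} {x : V}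
    [FiniteDimensional ℝ V]
    (hν : ∀ a, DifferentiableWithinAt ℝ (ν a) M x) (hx : x ∈ M)
    (hli : ∀ y ∈ M, LinearIndependent ℝ fun a => ν a y) {Z : V → V}
    (hZ : DifferentiableWithinAt ℝ Z M x) :
    ∃ c : Fin k → V → ℝ, (∀ a, DifferentiableWithinAt ℝ (c a) M x) ∧ ∀ y ∈ M,
      (Submodule.span ℝ (Set.range fun a => ν a y)).starProjection (Z y) = ∑ a, c a y • ν a y := by
  let G : V → Matrix (Fin k) (Fin k) ℝ := fun y => Matrix.gram ℝ fun a => ν a y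
  let z : V → Fin k → ℝ := fun y a => ⟪ν a y, Z y⟫_ℝ
  have hdet : ∀ y ∈ M, (G y).det ≠ 0 := fun y hy =>
    Matrix.det_gram_ne_zero_iff_linearIndependent.2 (hli y hy)
  have hGd : ∀ a b, DifferentiableWithinAt ℝ (fun y => G y a b) M x :=
    fun a b => (hν a).inner ℝ (hν b)
  refine ⟨fun a y => (G y).det⁻¹ * (G y).cramer (z y) a, fun a => ?_, fun y hy => ?_⟩
  · refine ((DifferentiableWithinAt.matrix_det hGd).inv (hdet x hx)).mul ?_
    simp only [Matrix.cramer_apply]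
    refine DifferentiableWithinAt.matrix_det fun i j => ?_
    by_cases hj : j = a
    · subst hj
      simpa using (hν i).inner ℝ hZ
    · simpa [Matrix.updateCol_ne hj] using hGd i j
  · have hmem : ∑ a, ((G y).det⁻¹ * (G y).cramer (z y) a) • ν a y ∈
        Submodule.span ℝ (Set.range fun a => ν a y) :=
      Submodule.sum_mem _ fun a _ => Submodule.smul_mem _ _ (Submodule.subset_span ⟨a, rfl⟩)
    refine Submodule.eq_starProjection_of_mem_of_inner_eq_zero hmem fun w hw => ?_
    refine Submodule.span_induction ?_ (by simp) (fun a b _ _ ha hb => by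
      rw [inner_add_right, ha, hb, add_zero]) (fun r a _ ha => by
      rw [inner_smul_right, ha, mul_zero]) hw
    rintro _ ⟨b, rfl⟩
    have h1 := congrFun (Matrix.mulVec_cramer (G y) (z y)) b
    have h2 : ∑ a, ⟪ν b y, ν a y⟫_ℝ * (G y).cramer (z y) a = (G y).det * ⟪ν b y, Z y⟫_ℝ := by
      simpa [Matrix.mulVec, dotProduct, G, z, Matrix.gram_apply] using h1
    rw [real_inner_comm, inner_sub_right, inner_sum]
    simp only [inner_smul_right]
    have h3 : ∑ a, (G y).det⁻¹ * (G y).cramer (z y) a * ⟪ν b y, ν a y⟫_ℝ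
        = (G y).det⁻¹ * ∑ a, ⟪ν b y, ν a y⟫_ℝ * (G y).cramer (z y) a := by
      rw [Finset.mul_sum]
      exact Finset.sum_congr rfl fun a _ => by ring
    rw [h3, h2, inv_mul_cancel_left₀ (hdet y hy), sub_self]

theorem tangentSpace_mono {M N : Set V} (h : M ⊆ N) (x : V) :
    tangentSpace M x ≤ tangentSpace N x :=
  Submodule.span_mono fun _ ⟨γ, ε, hε, hγ, hM, h0, hd⟩ =>
    ⟨γ, ε, hε, hγ, fun t ht => h (hM t ht), h0, hd⟩

variable [FiniteDimensional ℝ V]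

theorem sub_starProjection_normalSpace {M N : Set V} (h : M ⊆ N) {x u : V}
    (hu : u ∈ tangentSpace N x) :
    u - (normalSpace N M x).starProjection u = (tangentSpace M x).starProjection u := by
  have h1 : (normalSpace N M x).starProjection u = u - (tangentSpace M x).starProjection u := by
    refine Submodule.eq_starProjection_of_mem_of_inner_eq_zero ?_ fun w hw => ?_
    · exact ⟨Submodule.sub_mem _ hu (tangentSpace_mono h x (Submodule.starProjection_apply_mem _ _)),
        Submodule.sub_starProjection_mem_orthogonal _⟩
    · rw [sub_sub_cancel]
      exact hw.2 _ (Submodule.starProjection_apply_mem _ _)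
  rw [h1, sub_sub_cancel]

theorem starProjection_starProjection_of_le {K L : Submodule ℝ V} (h : K ≤ L) (u : V) :
    K.starProjection (L.starProjection u) = K.starProjection u := by
  refine (Submodule.eq_starProjection_of_mem_of_inner_eq_zero
    (Submodule.starProjection_apply_mem _ _) fun w hw => ?_).symm
  have h1 := Submodule.starProjection_inner_eq_zero (K := K) (L.starProjection u) w hw
  have h2 := Submodule.starProjection_inner_eq_zero (K := L) u w (h hw)
  rw [inner_sub_left] at h1 h2 ⊢
  linarith

theorem coe_shapeOperator {M N : Set V} (h : M ⊆ N) (ν : V → V) {x : V} (v : tangentSpace M x) :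
    (shapeOperator N M ν x v : V) =
      -(tangentSpace M x).starProjection (fderivWithin ℝ ν M x v) := by
  rw [← starProjection_starProjection_of_le (tangentSpace_mono h x)]
  rfl

theorem inner_shapeOperator {M N : Set V} (h : M ⊆ N) (ν : V → V) {x : V}
    (v w : tangentSpace M x) :
    ⟪shapeOperator N M ν x v, w⟫_ℝ = -⟪fderivWithin ℝ ν M x v, (w : V)⟫_ℝ := by
  rw [Submodule.coe_inner, coe_shapeOperator h, inner_neg_left,
    Submodule.inner_starProjection_left_eq_right, Submodule.starProjection_eq_self_iff.2 w.2]

/-- The shape operator is tensorial in the normal field: it is the same linear combination of the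
shape operators of a frame. -/
theorem exists_shapeOperator_eq_sum {M N : Set V} (hMN : M ⊆ N) {k : ℕ} {ν : Fin k → V → V}
    (hν : IsNormalFrame N M ν) {ξ : V → V} (hξ : IsNormalField N M ξ) {x : V} (hx : x ∈ M) :
    ∃ c : Fin k → ℝ, shapeOperator N M ξ x = ∑ a, c a • shapeOperator N M (ν a) x := by
  have hd : ∀ {ζ : V → V}, IsNormalField N M ζ → DifferentiableWithinAt ℝ ζ M x := fun hζ =>
    hζ.1.differentiableOn (by simp) x hx
  obtain ⟨c, hc, hsum⟩ := exists_differentiable_coeff (fun a => hd (hν.1 a)) hx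
    (fun y hy => (hν.2 y hy).1) (hd hξ)
  have heq : ∀ y ∈ M, ξ y = ∑ a, c a y • ν a y := fun y hy => by
    rw [← hsum y hy, (hν.2 y hy).2]
    exact (Submodule.starProjection_eq_self_iff.2 (hξ.2 y hy)).symm
  have hder : HasFDerivWithinAt ξ (∑ a, (c a x • fderivWithin ℝ (ν a) M x
      + (fderivWithin ℝ (c a) M x).smulRight (ν a x))) M x := by
    refine HasFDerivWithinAt.congr ?_ heq (heq x hx)
    exact HasFDerivWithinAt.fun_sum fun a _ =>
      (hc a).hasFDerivWithinAt.smul (hd (hν.1 a)).hasFDerivWithinAt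
  refine ⟨fun a => c a x, LinearMap.ext fun v => Subtype.ext ?_⟩
  have hnorm : ∀ a, (tangentSpace M x).starProjection (ν a x) = 0 := fun a =>
    (Submodule.starProjection_apply_eq_zero_iff _).2 ((hν.1 a).2 x hx).2
  rw [coe_shapeOperator hMN, fderivWithin_apply_of_mem_tangentSpace hder v.2]
  simp [coe_shapeOperator hMN, hnorm]

variable {W : Type*} [NormedAddCommGroup W] [NormedSpace ℝ W] [FiniteDimensional ℝ W]

theorem lieBracketWithin_mem_tangentSpace {h : V → W} (hh : ContDiff ℝ ∞ h) {X Y : V → V}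
    (hX : IsTangentField (regularZeros h) X) (hY : IsTangentField (regularZeros h) Y) {x : V}
    (hx : x ∈ regularZeros h) :
    VectorField.lieBracketWithin ℝ X Y (regularZeros h) x ∈ tangentSpace (regularZeros h) x := by
  set M := regularZeros h
  have hh1 : ContDiff ℝ ∞ (fderiv ℝ h) := hh.fderiv_right (by simp)
  have h2 : HasFDerivAt (fderiv ℝ h) (fderiv ℝ (fderiv ℝ h) x) x :=
    (hh1.differentiable (by simp) x).hasFDerivAt
  have hsymm : IsSymmSndFDerivAt ℝ h x :=
    hh.contDiffAt.isSymmSndFDerivAt (by simpa using ENat.LEInfty.out)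
  -- differentiate `Dh (Y) = 0` in the direction `v`
  have key : ∀ {Y : V → V}, IsTangentField M Y → ∀ v ∈ tangentSpace M x,
      fderiv ℝ (fderiv ℝ h) x v (Y x) + fderiv ℝ h x (fderivWithin ℝ Y M x v) = 0 := by
    intro Y hY v hv
    have hYd := (hY.1.differentiableOn (by simp) x hx).hasFDerivWithinAt
    have h3 := h2.hasFDerivWithinAt.clm_apply (s := M) hYd
    have h4 : HasFDerivWithinAt (fun y => fderiv ℝ h y (Y y)) (0 : V →L[ℝ] W) M x :=
      (hasFDerivWithinAt_const (0 : W) x _).congr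
        (fun y hy => (mem_tangentSpace_regularZeros hh hy).1 (hY.2 y hy))
        ((mem_tangentSpace_regularZeros hh hx).1 (hY.2 x hx))
    have h5 := (fderivWithin_apply_of_mem_tangentSpace h3 hv).symm.trans
      (fderivWithin_apply_of_mem_tangentSpace h4 hv)
    simpa [add_comm] using h5
  have hXY := key hY (X x) (hX.2 x hx)
  have hYX := key hX (Y x) (hY.2 x hx)
  have h6 := hsymm.eq (X x) (Y x)
  rw [mem_tangentSpace_regularZeros hh hx]
  simp only [VectorField.lieBracketWithin, map_sub]
  rw [eq_neg_of_add_eq_zero_right hXY, eq_neg_of_add_eq_zero_right hYX, h6, sub_self]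

end Frames

end SubmanifoldGeometry

/-! ### The Ricci equation -/

namespace SubmanifoldGeometry

section Flatness

variable {V : Type*} [NormedAddCommGroup V] [InnerProductSpace ℝ V] [FiniteDimensional ℝ V]

/-- The inner products with a normal frame of the derivative of the normal part `Z` of a field `D`
along `M`: differentiate `⟪Z, ν b⟫ = ⟪D, ν b⟫`. -/
theorem inner_fderivWithin_normal_part {M N : Set V} {k : ℕ} {ν : Fin k → V → V}
    (hν : IsNormalFrame N M ν) {x : V} (hx : x ∈ M) {D Z : V → V} {D' : V →L[ℝ] V}
    (hD : HasFDerivWithinAt D D' M x)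
    (hZ : ∀ᶠ y in 𝓝[M] x, Z y = (normalSpace N M y).starProjection (D y))
    {v : V} (hv : v ∈ tangentSpace M x) (b : Fin k) :
    ⟪fderivWithin ℝ Z M x v, ν b x⟫_ℝ =
      ⟪D' v, ν b x⟫_ℝ + ⟪D x - Z x, fderivWithin ℝ (ν b) M x v⟫_ℝ := by
  have hd : ∀ a, DifferentiableWithinAt ℝ (ν a) M x := fun a =>
    (hν.1 a).1.differentiableOn (by simp) x hx
  obtain ⟨c, hc, hsum⟩ := exists_differentiable_coeff hd hx
    (fun y hy => (hν.2 y hy).1) hD.differentiableWithinAt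
  have hZd : DifferentiableWithinAt ℝ Z M x := by
    have h1 : DifferentiableWithinAt ℝ (fun y => ∑ a, c a y • ν a y) M x :=
      DifferentiableWithinAt.fun_sum fun a _ => (hc a).smul (hd a)
    have h2 : Z =ᶠ[𝓝[M] x] fun y => ∑ a, c a y • ν a y := by
      filter_upwards [hZ, self_mem_nhdsWithin] with y hy hyM
      rw [hy, ← (hν.2 y hyM).2, hsum y hyM]
    exact h1.congr_of_eventuallyEq h2 (h2.self_of_nhdsWithin hx)
  have h1 := hZd.hasFDerivWithinAt.inner ℝ (hd b).hasFDerivWithinAt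
  have h2 := hD.inner ℝ (hd b).hasFDerivWithinAt
  have h3 : (fun y => ⟪Z y, ν b y⟫_ℝ) =ᶠ[𝓝[M] x] fun y => ⟪D y, ν b y⟫_ℝ := by
    filter_upwards [hZ, self_mem_nhdsWithin] with y hy hyM
    rw [hy, Submodule.inner_starProjection_left_eq_right,
      Submodule.starProjection_eq_self_iff.2 ((hν.1 b).2 y hyM)]
  have h4 := (fderivWithin_apply_of_mem_tangentSpace h1 hv).symm.trans
    (fderivWithin_apply_of_mem_tangentSpace
      (h2.congr_of_eventuallyEq h3 (h3.self_of_nhdsWithin hx)) hv)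
  simp only [ContinuousLinearMap.comp_apply, ContinuousLinearMap.prod_apply,
    fderivInnerCLM_apply] at h4
  rw [inner_sub_left]
  linarith

/-- The tangential parts of `u - u^⊥` and of a vector `w` tangent to `N` are the only ones that
contribute to their inner product. -/
theorem inner_sub_starProjection_normalSpace {M N : Set V} (hMN : M ⊆ N) {x u w : V}
    (hw : w ∈ tangentSpace N x) :
    ⟪u - (normalSpace N M x).starProjection u, w⟫_ℝ =
      ⟪(tangentSpace M x).starProjection u, (tangentSpace M x).starProjection w⟫_ℝ := by
  rw [inner_sub_left, Submodule.inner_starProjection_left_eq_right, ← inner_sub_right,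
    sub_starProjection_normalSpace hMN hw, Submodule.inner_starProjection_left_eq_right,
    Submodule.starProjection_eq_self_iff.2 (Submodule.starProjection_apply_mem _ _)]

variable {W : Type*} [NormedAddCommGroup W] [NormedSpace ℝ W] [FiniteDimensional ℝ W]

/-- The Ricci equation for a submanifold `M` of `N` that has a normal frame whose derivatives along
`M` stay tangent to `N`: the normal curvature is given by the commutators of the shape operators. -/
theorem inner_normalCurvature {h : V → W} (hh : ContDiff ℝ ∞ h) {N : Set V}
    (hMN : regularZeros h ⊆ N) {k : ℕ} {ν : Fin k → V → V}
    (hν : IsNormalFrame N (regularZeros h) ν)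
    (hνN : ∀ x ∈ regularZeros h, ∀ v ∈ tangentSpace (regularZeros h) x, ∀ a,
      fderivWithin ℝ (ν a) (regularZeros h) x v ∈ tangentSpace N x)
    {X Y ξ : V → V} (hX : IsTangentField (regularZeros h) X)
    (hY : IsTangentField (regularZeros h) Y) (hξ : IsNormalField N (regularZeros h) ξ) {x : V}
    (hx : x ∈ regularZeros h) (b : Fin k) :
    ⟪normalCurvature N (regularZeros h) X Y ξ x, ν b x⟫_ℝ =
      ⟪shapeOperator N (regularZeros h) ξ x ⟨Y x, hY.2 x hx⟩,
        shapeOperator N (regularZeros h) (ν b) x ⟨X x, hX.2 x hx⟩⟫_ℝ -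
      ⟪shapeOperator N (regularZeros h) ξ x ⟨X x, hX.2 x hx⟩,
        shapeOperator N (regularZeros h) (ν b) x ⟨Y x, hY.2 x hx⟩⟫_ℝ := by
  set M := regularZeros h with hM
  obtain ⟨U, hU, hxU, hext⟩ := exists_local_extension hh hx
  obtain ⟨ξ', hξ's, hξ'⟩ := hext ξ hξ.1
  have hnear : ∀ᶠ y in 𝓝[M] x, y ∈ M ∩ U :=
    Filter.inter_mem self_mem_nhdsWithin (mem_nhdsWithin_of_mem_nhds (hU.mem_nhds hxU))
  have hξ'x : ContDiffAt ℝ ∞ ξ' x := hξ's.contDiffAt (hU.mem_nhds hxU)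
  have hsymm : IsSymmSndFDerivAt ℝ ξ' x :=
    hξ'x.isSymmSndFDerivAt (by simpa using ENat.LEInfty.out)
  have hξ'' : HasFDerivAt (fderiv ℝ ξ') (fderiv ℝ (fderiv ℝ ξ') x) x :=
    ((hξ'x.fderiv_right (m := ∞) (by simp)).differentiableAt (by simp)).hasFDerivAt
  have hproj : ∀ {y}, ∀ u, (normalSpace N M y).starProjection ((tangentSpace N y).starProjection u)
      = (normalSpace N M y).starProjection u := fun u =>
    starProjection_starProjection_of_le inf_le_left u
  have hνx := fun u => Submodule.inner_starProjection_left_eq_right (normalSpace N M x) u (ν b x)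
  rw [Submodule.starProjection_eq_self_iff.2 ((hν.1 b).2 x hx)] at hνx
  -- the iterated normal derivative of `ξ`, along `Y` and then along `X`
  have key : ∀ {X Y : V → V} (hX : IsTangentField M X) (hY : IsTangentField M Y),
      ⟪normalConnection N M X (normalConnection N M Y ξ) x, ν b x⟫_ℝ =
        ⟪fderiv ℝ (fderiv ℝ ξ') x (X x) (Y x) + fderiv ℝ ξ' x (fderivWithin ℝ Y M x (X x)),
          ν b x⟫_ℝ + ⟪shapeOperator N M ξ x ⟨Y x, hY.2 x hx⟩,
        shapeOperator N M (ν b) x ⟨X x, hX.2 x hx⟩⟫_ℝ := by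
    intro X Y hX hY
    have hYd := (hY.1.differentiableOn (by simp) x hx).hasFDerivWithinAt
    have hD := hξ''.hasFDerivWithinAt.clm_apply (s := M) hYd
    have hZ : ∀ᶠ y in 𝓝[M] x, normalConnection N M Y ξ y =
        (normalSpace N M y).starProjection (fderiv ℝ ξ' y (Y y)) := by
      filter_upwards [hnear] with y hy
      rw [normalConnection, covDeriv, hproj,
        fderivWithin_apply_of_mem_tangentSpace (hξ' y hy).2 (hY.2 y hy.1)]
    have h1 := inner_fderivWithin_normal_part hν hx hD hZ (hX.2 x hx) b
    rw [hZ.self_of_nhdsWithin hx, inner_sub_starProjection_normalSpace hMN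
      (hνN x hx _ (hX.2 x hx) b)] at h1
    rw [normalConnection, covDeriv, hproj, hνx, h1, Submodule.coe_inner, coe_shapeOperator hMN,
      coe_shapeOperator hMN, inner_neg_neg,
      fderivWithin_apply_of_mem_tangentSpace (hξ' x ⟨hx, hxU⟩).2 (hY.2 x hx)]
    simp [add_comm]
  have hbr := lieBracketWithin_mem_tangentSpace hh hX hY hx
  have h3 : ⟪normalConnection N M (VectorField.lieBracketWithin ℝ X Y M) ξ x, ν b x⟫_ℝ =
      ⟪fderiv ℝ ξ' x (fderivWithin ℝ Y M x (X x)), ν b x⟫_ℝ -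
        ⟪fderiv ℝ ξ' x (fderivWithin ℝ X M x (Y x)), ν b x⟫_ℝ := by
    rw [normalConnection, covDeriv, hproj, hνx,
      fderivWithin_apply_of_mem_tangentSpace (hξ' x ⟨hx, hxU⟩).2 hbr,
      VectorField.lieBracketWithin, map_sub, inner_sub_left]
  rw [normalCurvature, inner_sub_left, inner_sub_left, key hX hY, key hY hX, h3,
    hsymm.eq (X x) (Y x), inner_add_left, inner_add_left]
  ring

theorem normalConnection_mem {N M : Set V} (X ξ : V → V) (x : V) :
    normalConnection N M X ξ x ∈ normalSpace N M x :=
  Submodule.starProjection_apply_mem _ _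

theorem hasFlatNormalBundle_of_commute {h : V → W} (hh : ContDiff ℝ ∞ h) {N : Set V}
    (hMN : regularZeros h ⊆ N) {k : ℕ} {ν : Fin k → V → V}
    (hν : IsNormalFrame N (regularZeros h) ν)
    (hνN : ∀ x ∈ regularZeros h, ∀ v ∈ tangentSpace (regularZeros h) x, ∀ a,
      fderivWithin ℝ (ν a) (regularZeros h) x v ∈ tangentSpace N x)
    (hS : ∀ x ∈ regularZeros h, ∀ a, (shapeOperator N (regularZeros h) (ν a) x).IsSymmetric)
    (hc : ∀ x ∈ regularZeros h, ∀ a b, Commute (shapeOperator N (regularZeros h) (ν a) x)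
      (shapeOperator N (regularZeros h) (ν b) x)) :
    HasFlatNormalBundle N (regularZeros h) := by
  intro X Y ξ hX hY hξ x hx
  have horth : ∀ b, ⟪normalCurvature N (regularZeros h) X Y ξ x, ν b x⟫_ℝ = 0 := by
    intro b
    rw [inner_normalCurvature hh hMN hν hνN hX hY hξ hx b]
    obtain ⟨c, hcsum⟩ := exists_shapeOperator_eq_sum hMN hν hξ hx
    have hcomm : Commute (shapeOperator N (regularZeros h) (ν b) x)
        (shapeOperator N (regularZeros h) ξ x) := by
      rw [hcsum]
      exact Commute.sum_right _ _ _ fun a _ => (hc x hx b a).smul_right _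
    have hsym : (shapeOperator N (regularZeros h) ξ x).IsSymmetric := by
      intro v w
      simp only [hcsum, LinearMap.sum_apply, LinearMap.smul_apply, sum_inner, inner_sum,
        real_inner_smul_left, real_inner_smul_right]
      exact Finset.sum_congr rfl fun a _ => by rw [hS x hx a v w]
    have hcomm' : ∀ u, shapeOperator N (regularZeros h) ξ x
        (shapeOperator N (regularZeros h) (ν b) x u) = shapeOperator N (regularZeros h) (ν b) x
          (shapeOperator N (regularZeros h) ξ x u) := fun u => (LinearMap.congr_fun hcomm.eq u).symm
    exact sub_eq_zero.2 (by rw [hsym, hcomm', ← hS x hx b, real_inner_comm])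
  have hmem : normalCurvature N (regularZeros h) X Y ξ x ∈ normalSpace N (regularZeros h) x :=
    Submodule.sub_mem _ (Submodule.sub_mem _ (normalConnection_mem _ _ _)
      (normalConnection_mem _ _ _)) (normalConnection_mem _ _ _)
  rw [← (hν.2 x hx).2] at hmem
  refine inner_self_eq_zero (𝕜 := ℝ).1 ?_
  refine Submodule.span_induction (p := fun w _ => ⟪normalCurvature N _ X Y ξ x, w⟫_ℝ = 0)
    ?_ (by simp) (fun a b _ _ ha hb => by rw [inner_add_right, ha, hb, add_zero])
    (fun r a _ ha => by rw [inner_smul_right, ha, mul_zero]) hmem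
  rintro _ ⟨b, rfl⟩
  exact horth b

end Flatness

end SubmanifoldGeometry

/-! ### Gradients on level sets, and spheres -/

namespace SubmanifoldGeometry

section Gradients

variable {V : Type*} [NormedAddCommGroup V] [InnerProductSpace ℝ V] [FiniteDimensional ℝ V]
  {W : Type*} [NormedAddCommGroup W] [NormedSpace ℝ W] [FiniteDimensional ℝ W]

/-- The regular zeros of the restriction of `Φ` to a regular level set of `h` are the common regular
zeros of `h` and `Φ`. -/
theorem mem_regularZeros_prod {W' : Type*} [NormedAddCommGroup W'] [NormedSpace ℝ W']
    {h : V → W} (hh : ContDiff ℝ ∞ h) {Φ : V → W'} (hΦ : ContDiff ℝ ∞ Φ) {x : V} :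
    x ∈ regularZeros (fun y => (h y, Φ y)) ↔ x ∈ regularZeros h ∧ Φ x = 0 ∧
      Function.Surjective (differential (regularZeros h) Φ x) := by
  have hhx : HasFDerivAt h (fderiv ℝ h x) x := (hh.differentiable (by simp) x).hasFDerivAt
  have hΦx : HasFDerivAt Φ (fderiv ℝ Φ x) x := (hΦ.differentiable (by simp) x).hasFDerivAt
  have hd : fderiv ℝ (fun y => (h y, Φ y)) x = (fderiv ℝ h x).prod (fderiv ℝ Φ x) :=
    (hhx.prodMk hΦx).fderiv
  have hdiff : ∀ v, differential (regularZeros h) Φ x v = fderiv ℝ Φ x v := fun v =>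
    differential_apply hΦx.hasFDerivWithinAt v
  constructor
  · rintro ⟨h0, hs⟩
    rw [hd] at hs
    have hx : x ∈ regularZeros h := by
      refine ⟨congrArg Prod.fst h0, fun w => ?_⟩
      obtain ⟨v, hv⟩ := hs (w, 0)
      exact ⟨v, congrArg Prod.fst hv⟩
    refine ⟨hx, congrArg Prod.snd h0, fun w => ?_⟩
    obtain ⟨v, hv⟩ := hs (0, w)
    refine ⟨⟨v, (mem_tangentSpace_regularZeros hh hx).2 (congrArg Prod.fst hv)⟩, ?_⟩
    rw [hdiff]
    exact congrArg Prod.snd hv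
  · rintro ⟨hx, h0, hs⟩
    refine ⟨Prod.ext hx.1 h0, ?_⟩
    rintro ⟨w, w'⟩
    obtain ⟨v, hv⟩ := hx.2 w
    obtain ⟨u, hu⟩ := hs (w' - fderiv ℝ Φ x v)
    rw [hdiff] at hu
    refine ⟨v + u, ?_⟩
    rw [hd]
    simp [hv, hu, (mem_tangentSpace_regularZeros hh hx).1 u.2]

theorem grad_mem (N : Set V) (f : V → ℝ) (x : V) : grad N f x ∈ tangentSpace N x :=
  Subtype.property _

theorem inner_grad {N : Set V} {f : V → ℝ} {f' : V →L[ℝ] ℝ} {x v : V}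
    (hf : HasFDerivWithinAt f f' N x) (hv : v ∈ tangentSpace N x) :
    ⟪grad N f x, v⟫_ℝ = f' v := by
  rw [grad, ← differential_apply hf ⟨v, hv⟩, ← Submodule.coe_inner _ _ (⟨v, hv⟩ : tangentSpace N x),
    InnerProductSpace.toDual_symm_apply]
  rfl

theorem grad_eq {N : Set V} {f : V → ℝ} {f' : V →L[ℝ] ℝ} {x g : V}
    (hf : HasFDerivWithinAt f f' N x) (hg : g ∈ tangentSpace N x)
    (h : ∀ v ∈ tangentSpace N x, ⟪g, v⟫_ℝ = f' v) : grad N f x = g := by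
  have hmem : grad N f x - g ∈ tangentSpace N x := Submodule.sub_mem _ (grad_mem _ _ _) hg
  refine sub_eq_zero.1 (inner_self_eq_zero (𝕜 := ℝ).1 ?_)
  nth_rewrite 1 [inner_sub_left]
  rw [inner_grad hf hmem, h _ hmem, sub_self]

theorem mem_tangentSpace_prod_iff {k : ℕ} {h : V → W} (hh : ContDiff ℝ ∞ h)
    {Φ : V → Fin k → ℝ} (hΦ : ContDiff ℝ ∞ Φ) {x : V}
    (hx : x ∈ regularZeros (fun y => (h y, Φ y))) {v : V} :
    v ∈ tangentSpace (regularZeros (fun y => (h y, Φ y))) x ↔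
      v ∈ tangentSpace (regularZeros h) x ∧
        ∀ a, ⟪grad (regularZeros h) (fun y => Φ y a) x, v⟫_ℝ = 0 := by
  have hxh := ((mem_regularZeros_prod hh hΦ).1 hx).1
  have hhx : HasFDerivAt h (fderiv ℝ h x) x := (hh.differentiable (by simp) x).hasFDerivAt
  have hΦx : HasFDerivAt Φ (fderiv ℝ Φ x) x := (hΦ.differentiable (by simp) x).hasFDerivAt
  have hd : fderiv ℝ (fun y => (h y, Φ y)) x = (fderiv ℝ h x).prod (fderiv ℝ Φ x) :=
    (hhx.prodMk hΦx).fderiv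
  have hg : ∀ w ∈ tangentSpace (regularZeros h) x, ∀ a,
      ⟪grad (regularZeros h) (fun y => Φ y a) x, w⟫_ℝ = fderiv ℝ Φ x w a := fun w hw a =>
    inner_grad ((hasFDerivAt_pi'.1 hΦx) a).hasFDerivWithinAt hw
  rw [mem_tangentSpace_regularZeros (hh.prodMk hΦ) hx, hd, ContinuousLinearMap.prod_apply,
    Prod.mk_eq_zero, mem_tangentSpace_regularZeros hh hxh]
  refine and_congr_right fun hv => ?_
  rw [funext_iff]
  exact forall_congr' fun a => by
    rw [hg v ((mem_tangentSpace_regularZeros hh hxh).2 hv) a]; rfl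

/-- The gradients on a regular level set of `h` of the components of `Φ` span the normal spaces of
the set of the regular zeros of `Φ`, and they are linearly independent there. -/
theorem isNormalFrame_grad {k : ℕ} {h : V → W} (hh : ContDiff ℝ ∞ h)
    {Φ : V → Fin k → ℝ} (hΦ : ContDiff ℝ ∞ Φ)
    (hsmooth : ∀ a, ContDiffOn ℝ ∞ (grad (regularZeros h) fun y => Φ y a)
      (regularZeros fun y => (h y, Φ y))) :
    IsNormalFrame (regularZeros h) (regularZeros fun y => (h y, Φ y))
      (fun a => grad (regularZeros h) fun y => Φ y a) := by
  have hnormal : ∀ x ∈ regularZeros (fun y => (h y, Φ y)), ∀ a,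
      grad (regularZeros h) (fun y => Φ y a) x ∈
        normalSpace (regularZeros h) (regularZeros fun y => (h y, Φ y)) x := fun x hx a =>
    ⟨grad_mem _ _ _, (Submodule.mem_orthogonal' _ _).2 fun u hu =>
      ((mem_tangentSpace_prod_iff hh hΦ hx).1 hu).2 a⟩
  refine ⟨fun a => ⟨hsmooth a, fun x hx => hnormal x hx a⟩, fun x hx => ⟨?_, ?_⟩⟩
  · have hΦx : HasFDerivAt Φ (fderiv ℝ Φ x) x := (hΦ.differentiable (by simp) x).hasFDerivAt
    rw [Fintype.linearIndependent_iff]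
    intro c hc
    -- pair the relation with a tangent vector that `dΦ` maps to the vector of coefficients
    obtain ⟨v, hv⟩ := ((mem_regularZeros_prod hh hΦ).1 hx).2.2 c
    rw [differential_apply hΦx.hasFDerivWithinAt] at hv
    have h1 : ∑ a, c a * c a = 0 := by
      have h2 := congrArg (fun u => ⟪u, (v : V)⟫_ℝ) hc
      simp only [sum_inner, real_inner_smul_left, inner_zero_left] at h2
      rw [← h2]
      refine Finset.sum_congr rfl fun a _ => ?_
      rw [inner_grad ((hasFDerivAt_pi'.1 hΦx) a).hasFDerivWithinAt v.2]
      conv_lhs => rw [← hv]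
      simp [hv]
    intro a
    exact mul_self_eq_zero.1 ((Finset.sum_eq_zero_iff_of_nonneg fun a _ => mul_self_nonneg _).1 h1 a
      (Finset.mem_univ a))
  · set G := Submodule.span ℝ (Set.range fun a => grad (regularZeros h) (fun y => Φ y a) x)
    have hG : G ≤ normalSpace (regularZeros h) (regularZeros fun y => (h y, Φ y)) x :=
      Submodule.span_le.2 (by rintro _ ⟨a, rfl⟩; exact hnormal x hx a)
    refine le_antisymm hG fun u hu => ?_
    have h1 : u - G.starProjection u ∈
        normalSpace (regularZeros h) (regularZeros fun y => (h y, Φ y)) x :=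
      Submodule.sub_mem _ hu (hG (Submodule.starProjection_apply_mem _ _))
    have h2 : u - G.starProjection u ∈
        tangentSpace (regularZeros fun y => (h y, Φ y)) x :=
      (mem_tangentSpace_prod_iff hh hΦ hx).2 ⟨h1.1, fun a =>
        Submodule.sub_starProjection_mem_orthogonal u _ (Submodule.subset_span ⟨a, rfl⟩)⟩
    have h3 : u - G.starProjection u = 0 := inner_self_eq_zero (𝕜 := ℝ).1 (h1.2 _ h2)
    rw [sub_eq_zero.1 h3]
    exact Submodule.starProjection_apply_mem _ _

end Gradients

section Spheres

variable {V : Type*} [NormedAddCommGroup V] [InnerProductSpace ℝ V] [FiniteDimensional ℝ V]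

/-- A defining map of the unit sphere of a linear subspace `E` of `V`: the component orthogonal to
`E`, and the deviation of the squared norm from `1`. -/
noncomputable def sphereMap (E : Submodule ℝ V) (x : V) : Eᗮ × ℝ :=
  (Eᗮ.orthogonalProjectionOnto x, ‖x‖ ^ 2 - 1)

theorem contDiff_sphereMap (E : Submodule ℝ V) : ContDiff ℝ ∞ (sphereMap E) :=
  (ContinuousLinearMap.contDiff _).prodMk ((contDiff_norm_sq ℝ).sub contDiff_const)

theorem fderiv_sphereMap (E : Submodule ℝ V) (x v : V) :
    fderiv ℝ (sphereMap E) x v = (Eᗮ.orthogonalProjectionOnto v, 2 * ⟪x, v⟫_ℝ) := by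
  have h1 : HasFDerivAt (fun y : V => ‖y‖ ^ 2 - 1) (2 • innerSL ℝ x) x :=
    (hasStrictFDerivAt_norm_sq x).hasFDerivAt.sub_const 1
  have h2 := (Eᗮ.orthogonalProjectionOnto.hasFDerivAt (x := x)).prodMk h1
  have h3 : fderiv ℝ (sphereMap E) x = _ := h2.fderiv
  rw [h3]
  simp

theorem orthogonalProjectionOnto_orthogonal_eq_zero_iff {E : Submodule ℝ V} {x : V} :
    Eᗮ.orthogonalProjectionOnto x = 0 ↔ x ∈ E := by
  rw [Submodule.orthogonalProjectionOnto_eq_zero_iff, Submodule.orthogonal_orthogonal]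

theorem mem_regularZeros_sphereMap {E : Submodule ℝ V} {x : V} :
    x ∈ regularZeros (sphereMap E) ↔ x ∈ E ∧ ‖x‖ = 1 := by
  have h0 : sphereMap E x = 0 ↔ x ∈ E ∧ ‖x‖ = 1 := by
    rw [sphereMap, Prod.mk_eq_zero, orthogonalProjectionOnto_orthogonal_eq_zero_iff, sub_eq_zero,
      pow_eq_one_iff_of_nonneg (norm_nonneg x) two_ne_zero]
  refine ⟨fun h => h0.1 h.1, fun h => ⟨h0.2 h, ?_⟩⟩
  -- the differential is surjective: the vectors orthogonal to `E` and the radial one suffice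
  rintro ⟨w, t⟩
  refine ⟨w + (t / 2) • x, ?_⟩
  rw [fderiv_sphereMap, map_add, map_smul, orthogonalProjectionOnto_orthogonal_eq_zero_iff.2 h.1,
    Submodule.orthogonalProjectionOnto_mem_subspace_eq_self, inner_add_right, inner_smul_right,
    real_inner_self_eq_norm_sq, h.2, w.2 x h.1]
  simp
  ring

theorem mem_tangentSpace_sphereMap {E : Submodule ℝ V} {x v : V}
    (hx : x ∈ regularZeros (sphereMap E)) :
    v ∈ tangentSpace (regularZeros (sphereMap E)) x ↔ v ∈ E ∧ ⟪x, v⟫_ℝ = 0 := by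
  rw [mem_tangentSpace_regularZeros (contDiff_sphereMap E) hx, fderiv_sphereMap, Prod.mk_eq_zero,
    orthogonalProjectionOnto_orthogonal_eq_zero_iff, mul_eq_zero_iff_left (two_ne_zero)]

end Spheres

end SubmanifoldGeometry

/-! ### Hermitian matrices and the derivatives of their powers -/

namespace HermitianMatrices

open SubmanifoldGeometry

/-- The common properties of `ℝ`, `ℂ` and `ℍ` on which the geometry of Hermitian matrices depends:
the multiplications by `a` and by `star a` are adjoint to each other, the unit has norm one, and the
self-adjoint elements are the real ones. -/
class IsEuclideanStarRing (𝔽 : Type) [NormedRing 𝔽] [InnerProductSpace ℝ 𝔽] [StarRing 𝔽] : Prop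
    extends IsScalarTower ℝ 𝔽 𝔽, SMulCommClass ℝ 𝔽 𝔽, StarModule ℝ 𝔽 where
  inner_mul_left' : ∀ a b c : 𝔽, ⟪a * b, c⟫_ℝ = ⟪b, star a * c⟫_ℝ
  inner_mul_right' : ∀ a b c : 𝔽, ⟪b * a, c⟫_ℝ = ⟪b, c * star a⟫_ℝ
  inner_one_one' : ⟪(1 : 𝔽), 1⟫_ℝ = 1
  eq_smul_one_of_star_eq : ∀ a : 𝔽, star a = a → a = ⟪1, a⟫_ℝ • (1 : 𝔽)

instance : IsEuclideanStarRing ℝ where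
  inner_mul_left' a b c := by simp; ring
  inner_mul_right' a b c := by simp; ring
  inner_one_one' := by simp
  eq_smul_one_of_star_eq a _ := by simp

instance : IsEuclideanStarRing ℂ where
  inner_mul_left' a b c := by simp [Complex.inner]; ring
  inner_mul_right' a b c := by simp [Complex.inner]; ring
  inner_one_one' := by simp
  eq_smul_one_of_star_eq a h := by
    have h1 := congrArg Complex.im h
    apply Complex.ext
    · simp [Complex.inner]
    · simp only [Complex.star_def, Complex.conj_im] at h1
      simp [Complex.inner]
      linarith

instance : IsEuclideanStarRing ℍ[ℝ] where
  star_smul r a := by ext <;> simp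
  inner_mul_left' a b c := by simp [Quaternion.inner_def]; ring
  inner_mul_right' a b c := by simp [Quaternion.inner_def]; ring
  inner_one_one' := by simp
  eq_smul_one_of_star_eq a h := by
    have h1 := congrArg QuaternionAlgebra.imI h
    have h2 := congrArg QuaternionAlgebra.imJ h
    have h3 := congrArg QuaternionAlgebra.imK h
    simp only [Quaternion.imI_star, Quaternion.imJ_star, Quaternion.imK_star] at h1 h2 h3
    ext
    · simp [Quaternion.inner_def]
    · simp [Quaternion.inner_def]
      linarith
    · simp [Quaternion.inner_def]
      linarith
    · simp [Quaternion.inner_def]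
      linarith

section Algebra

variable {n : ℕ} {𝔽 : Type} [NormedRing 𝔽] [InnerProductSpace ℝ 𝔽]

theorem inner_matrix_def (X Y : Matrix (Fin n) (Fin n) 𝔽) :
    ⟪X, Y⟫_ℝ = ∑ i, ∑ j, ⟪X i j, Y i j⟫_ℝ := rfl

theorem inner_one_left (X : Matrix (Fin n) (Fin n) 𝔽) : ⟪1, X⟫_ℝ = ⟪1, X.trace⟫_ℝ := by
  rw [inner_matrix_def, Matrix.trace, inner_sum]
  refine Finset.sum_congr rfl fun i _ => ?_
  rw [Finset.sum_eq_single i (fun j _ hj => by rw [Matrix.one_apply_ne hj.symm, inner_zero_left])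
    (by simp), Matrix.one_apply_eq, Matrix.diag_apply]

theorem f_eq_inner (k : ℕ) (A : Matrix (Fin n) (Fin n) 𝔽) : f n 𝔽 k A = ⟪1, A ^ k⟫_ℝ :=
  (inner_one_left _).symm

variable [StarRing 𝔽] [IsEuclideanStarRing 𝔽]

theorem inner_star_star (a b : 𝔽) : ⟪star a, star b⟫_ℝ = ⟪a, b⟫_ℝ := by
  have h1 := IsEuclideanStarRing.inner_mul_left' (star a) 1 (star b)
  have h2 := IsEuclideanStarRing.inner_mul_right' b 1 a
  rw [mul_one, star_star] at h1
  rw [one_mul] at h2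
  rw [h1, ← h2, real_inner_comm]

theorem star_mul_self_eq (a : 𝔽) : star a * a = ‖a‖ ^ 2 • (1 : 𝔽) := by
  rw [IsEuclideanStarRing.eq_smul_one_of_star_eq (star a * a) (by simp),
    ← IsEuclideanStarRing.inner_mul_left', mul_one, real_inner_self_eq_norm_sq]

theorem inner_mul_left (A X Y : Matrix (Fin n) (Fin n) 𝔽) : ⟪A * X, Y⟫_ℝ = ⟪X, Aᴴ * Y⟫_ℝ := by
  simp only [inner_matrix_def, Matrix.mul_apply, sum_inner, inner_sum, Matrix.conjTranspose_apply,
    IsEuclideanStarRing.inner_mul_left']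
  rw [Finset.sum_comm_cycle]
  refine Finset.sum_congr rfl fun i _ => ?_
  rw [Finset.sum_comm]

theorem inner_conjTranspose (X Y : Matrix (Fin n) (Fin n) 𝔽) : ⟪Xᴴ, Yᴴ⟫_ℝ = ⟪X, Y⟫_ℝ := by
  simp only [inner_matrix_def, Matrix.conjTranspose_apply, inner_star_star]
  exact Finset.sum_comm

theorem inner_mul_right (A X Y : Matrix (Fin n) (Fin n) 𝔽) : ⟪X * A, Y⟫_ℝ = ⟪X, Y * Aᴴ⟫_ℝ := by
  rw [← inner_conjTranspose, Matrix.conjTranspose_mul, inner_mul_left, ← inner_conjTranspose]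
  simp [Matrix.conjTranspose_mul]

theorem smul_mul_matrix (r : ℝ) (X Y : Matrix (Fin n) (Fin n) 𝔽) : (r • X) * Y = r • (X * Y) :=
  Matrix.smul_mul r X Y

theorem mul_smul_matrix (r : ℝ) (X Y : Matrix (Fin n) (Fin n) 𝔽) : X * (r • Y) = r • (X * Y) :=
  Matrix.mul_smul X r Y

theorem trace_eq_of_isHermitian {X : Matrix (Fin n) (Fin n) 𝔽} (hX : X.IsHermitian) :
    X.trace = ⟪1, X⟫_ℝ • (1 : 𝔽) := by
  rw [inner_one_left]
  refine IsEuclideanStarRing.eq_smul_one_of_star_eq _ ?_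
  rw [← Matrix.trace_conjTranspose, hX.eq]

theorem trace_eq_zero_iff {X : Matrix (Fin n) (Fin n) 𝔽} (hX : X.IsHermitian) :
    X.trace = 0 ↔ ⟪1, X⟫_ℝ = 0 := by
  constructor
  · intro h
    rw [inner_one_left, h, inner_zero_right]
  · intro h
    rw [trace_eq_of_isHermitian hX, h, zero_smul]

end Algebra

section Powers

variable {n : ℕ} {𝔽 : Type} [NormedRing 𝔽] [InnerProductSpace ℝ 𝔽] [StarRing 𝔽]
  [IsEuclideanStarRing 𝔽]

/-- The differential `X ↦ ∑ A ^ i * X * A ^ (k - 1 - i)` of `A ↦ A ^ k`. -/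
def powDeriv (k : ℕ) (A : Matrix (Fin n) (Fin n) 𝔽) :
    Matrix (Fin n) (Fin n) 𝔽 →ₗ[ℝ] Matrix (Fin n) (Fin n) 𝔽 where
  toFun X := ∑ i ∈ Finset.range k, A ^ i * X * A ^ (k - 1 - i)
  map_add' X Y := by simp [mul_add, add_mul, Finset.sum_add_distrib]
  map_smul' r X := by simp [Finset.smul_sum]

theorem powDeriv_apply (k : ℕ) (A X : Matrix (Fin n) (Fin n) 𝔽) :
    powDeriv k A X = ∑ i ∈ Finset.range k, A ^ i * X * A ^ (k - 1 - i) := rfl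

theorem powDeriv_succ (k : ℕ) (A X : Matrix (Fin n) (Fin n) 𝔽) :
    powDeriv (k + 1) A X = A ^ k * X + powDeriv k A X * A := by
  rw [powDeriv_apply, powDeriv_apply, Finset.sum_range_succ, Finset.sum_mul, add_comm]
  congr 1
  · simp
  · refine Finset.sum_congr rfl fun i hi => ?_
    have hi' := Finset.mem_range.1 hi
    rw [mul_assoc _ _ A, ← pow_succ]
    congr 2
    omega

variable [FiniteDimensional ℝ 𝔽]

/-- The multiplication of matrices as a continuous bilinear map. -/
noncomputable def mulCLM (n : ℕ) (𝔽 : Type) [NormedRing 𝔽] [InnerProductSpace ℝ 𝔽] [StarRing 𝔽]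
    [IsEuclideanStarRing 𝔽] [FiniteDimensional ℝ 𝔽] :
    Matrix (Fin n) (Fin n) 𝔽 →L[ℝ] Matrix (Fin n) (Fin n) 𝔽 →L[ℝ] Matrix (Fin n) (Fin n) 𝔽 :=
  (LinearMap.mk₂ ℝ (fun X Y => X * Y) add_mul smul_mul_matrix mul_add
    mul_smul_matrix).toContinuousBilinearMap

theorem hasFDerivAt_pow (k : ℕ) (A : Matrix (Fin n) (Fin n) 𝔽) :
    HasFDerivAt (fun X : Matrix (Fin n) (Fin n) 𝔽 => X ^ k)
      (LinearMap.toContinuousLinearMap (powDeriv k A)) A := by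
  induction k with
  | zero =>
    have : LinearMap.toContinuousLinearMap (powDeriv 0 A) = 0 := by
      ext X : 1
      simp [powDeriv_apply]
    rw [this]
    simpa using hasFDerivAt_const (1 : Matrix (Fin n) (Fin n) 𝔽) A
  | succ k ih =>
    have h1 := (mulCLM n 𝔽).hasFDerivAt_of_bilinear ih (hasFDerivAt_id A)
    have h2 : (fun X : Matrix (Fin n) (Fin n) 𝔽 => X ^ (k + 1)) =
        fun X => mulCLM n 𝔽 (X ^ k) (id X) := funext fun X => pow_succ X k
    rw [h2]
    refine h1.congr_fderiv (ContinuousLinearMap.ext fun X => ?_)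
    exact (powDeriv_succ k A X).symm

theorem contDiff_pow_matrix (k : ℕ) :
    ContDiff ℝ ∞ (fun X : Matrix (Fin n) (Fin n) 𝔽 => X ^ k) := by
  induction k with
  | zero => simpa using contDiff_const
  | succ k ih =>
    simp only [pow_succ]
    exact ((mulCLM n 𝔽).contDiff.comp ih).clm_apply contDiff_id

end Powers

end HermitianMatrices

/-! ### Power sums and the spectral theorem -/

namespace HermitianMatrices

open SubmanifoldGeometry

section PowerSums

/-- By Newton's identities the odd power sums up to the `n`-th determine the symmetry of a family of
`n` numbers: `d` and `-d` have the same elementary symmetric functions. -/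
theorem isSignSymmetric_of_sum_odd_pow {n : ℕ} {d : Fin n → ℝ}
    (h : ∀ k, Odd k → k ≤ n → ∑ i, d i ^ k = 0) : IsSignSymmetric d := by
  have hp : ∀ k, k ≤ n → MvPolynomial.aeval d (MvPolynomial.psum (Fin n) ℝ k) =
      MvPolynomial.aeval (fun i => -d i) (MvPolynomial.psum (Fin n) ℝ k) := by
    intro k hk
    simp only [MvPolynomial.psum, map_sum, map_pow, MvPolynomial.aeval_X]
    rcases Nat.even_or_odd k with he | ho
    · simp [he.neg_pow]
    · simp [ho.neg_pow, h k ho hk]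
  have he : ∀ k, k ≤ n → MvPolynomial.aeval d (MvPolynomial.esymm (Fin n) ℝ k) =
      MvPolynomial.aeval (fun i => -d i) (MvPolynomial.esymm (Fin n) ℝ k) := by
    intro k
    induction k using Nat.strong_induction_on with
    | _ k ih =>
      intro hk
      rcases Nat.eq_zero_or_pos k with rfl | hpos
      · simp
      have hk0 : (k : ℝ) ≠ 0 := by positivity
      have hN := MvPolynomial.mul_esymm_eq_sum (Fin n) ℝ k
      have h1 := congrArg (MvPolynomial.aeval d) hN
      have h2 := congrArg (MvPolynomial.aeval fun i => -d i) hN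
      simp only [map_mul, map_natCast, map_pow, map_neg, map_one, map_sum] at h1 h2
      refine mul_left_cancel₀ hk0 ?_
      rw [h1, h2]
      congr 1
      refine Finset.sum_congr rfl fun a ha => ?_
      rw [Finset.mem_filter, Finset.HasAntidiagonal.mem_antidiagonal] at ha
      rw [ih a.1 ha.2 (by omega), hp a.2 (by omega)]
  apply isSignSymmetric_of_map_eq
  rw [← Polynomial.roots_multiset_prod_X_sub_C (Finset.univ.val.map d),
    ← Polynomial.roots_multiset_prod_X_sub_C (Finset.univ.val.map fun i => -d i),
    Multiset.prod_X_sub_X_eq_sum_esymm, Multiset.prod_X_sub_X_eq_sum_esymm]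
  congr 1
  have hcard : ∀ e : Fin n → ℝ, (Finset.univ.val.map e).card = n := by simp
  rw [hcard, hcard]
  refine Finset.sum_congr rfl fun j hj => ?_
  have := he j (Nat.lt_succ_iff.1 (Finset.mem_range.1 hj))
  rw [MvPolynomial.aeval_esymm_eq_multiset_esymm, MvPolynomial.aeval_esymm_eq_multiset_esymm] at this
  rw [this]

theorem card_image_sq_le {n : ℕ} (hn : 0 < n) {d : Fin n → ℝ} (hd : IsSignSymmetric d) :
    (Finset.univ.image fun i => d i ^ 2).card ≤ (n - 1) / 2 + 1 := by
  classical
  obtain ⟨σ, hσ⟩ := hd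
  set P := Finset.univ.filter fun i => 0 < d i with hP
  set Q := Finset.univ.filter fun i => d i < 0 with hQ
  set Z := Finset.univ.filter fun i => d i = 0 with hZ
  have hPQ : P.card = Q.card := Finset.card_equiv σ fun i => by simp [hP, hQ, hσ]
  have hn' : P.card + Q.card + Z.card = n := by
    have h1 : Disjoint P Q := Finset.disjoint_left.2 fun i hi hi' => by
      simp only [hP, hQ, Finset.mem_filter] at hi hi'; linarith [hi.2, hi'.2]
    have h2 : Disjoint (P ∪ Q) Z := Finset.disjoint_left.2 fun i hi hi' => by
      simp only [hP, hQ, hZ, Finset.mem_union, Finset.mem_filter] at hi hi'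
      rcases hi with hi | hi <;> linarith [hi.2, hi'.2]
    rw [← Finset.card_union_of_disjoint h1, ← Finset.card_union_of_disjoint h2]
    have h3 : P ∪ Q ∪ Z = Finset.univ := by
      ext i
      simp only [hP, hQ, hZ, Finset.mem_union, Finset.mem_filter, Finset.mem_univ, true_and,
        iff_true]
      rcases lt_trichotomy (d i) 0 with h | h | h <;> simp [h]
    rw [h3, Finset.card_univ, Fintype.card_fin]
  have hsub : (Finset.univ.image fun i => d i ^ 2) ⊆
      P.image (fun i => d i ^ 2) ∪ Z.image (fun i => d i ^ 2) := by
    intro μ hμ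
    obtain ⟨i, -, rfl⟩ := Finset.mem_image.1 hμ
    rw [Finset.mem_union, Finset.mem_image, Finset.mem_image]
    rcases lt_trichotomy (d i) 0 with h | h | h
    · exact Or.inl ⟨σ i, by simp [hP, hσ, h], by simp [hσ]⟩
    · exact Or.inr ⟨i, by simp [hZ, h], rfl⟩
    · exact Or.inl ⟨i, by simp [hP, h], rfl⟩
  have hZ1 : (Z.image fun i => d i ^ 2).card ≤ 1 := by
    rw [Finset.card_le_one]
    intro a ha b hb
    obtain ⟨i, hi, rfl⟩ := Finset.mem_image.1 ha
    obtain ⟨j, hj, rfl⟩ := Finset.mem_image.1 hb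
    rw [(Finset.mem_filter.1 hi).2, (Finset.mem_filter.1 hj).2]
  have h4 := (Finset.card_le_card hsub).trans (Finset.card_union_le _ _)
  have h5 : (P.image fun i => d i ^ 2).card ≤ P.card := Finset.card_image_le
  have h6 : (Z.image fun i => d i ^ 2).card ≤ Z.card := Finset.card_image_le
  omega

/-- Finitely many numbers, `m` of them at most, are roots of a common monic polynomial of
degree `m`. -/
theorem exists_pow_eq_sum (s : Finset ℝ) {m : ℕ} (hs : s.card ≤ m) :
    ∃ c : Fin m → ℝ, ∀ μ ∈ s, μ ^ m = ∑ a, c a * μ ^ (a : ℕ) := by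
  let q : Polynomial ℝ := (∏ ν ∈ s, (Polynomial.X - Polynomial.C ν)) * Polynomial.X ^ (m - s.card)
  have hm1 : (∏ ν ∈ s, (Polynomial.X - Polynomial.C ν)).Monic :=
    Polynomial.monic_prod_of_monic _ _ fun ν _ => Polynomial.monic_X_sub_C ν
  have hq : q.Monic := hm1.mul (Polynomial.monic_X_pow _)
  have hdeg : q.natDegree = m := by
    rw [Polynomial.Monic.natDegree_mul hm1 (Polynomial.monic_X_pow _),
      Polynomial.natDegree_X_pow, Polynomial.natDegree_finsetProd_X_sub_C_eq_card]
    omega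
  refine ⟨fun a => -q.coeff a, fun μ hμ => ?_⟩
  have h0 : q.eval μ = 0 := by
    rw [Polynomial.eval_mul, Polynomial.eval_prod, Finset.prod_eq_zero hμ (by simp), zero_mul]
  rw [Polynomial.eval_eq_sum_range, hdeg, Finset.sum_range_succ, ← hdeg, hq.coeff_natDegree, hdeg,
    one_mul, Finset.sum_range] at h0
  simp only [neg_mul, Finset.sum_neg_distrib]
  linarith

end PowerSums

section Spectral

variable {n : ℕ} {𝔽 : Type} [NormedRing 𝔽] [InnerProductSpace ℝ 𝔽] [StarRing 𝔽]
  [IsEuclideanStarRing 𝔽] [FiniteDimensional ℝ 𝔽]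

/-- The real diagonal matrix with the given entries. -/
def realDiagonal (n : ℕ) (𝔽 : Type) [NormedRing 𝔽] [InnerProductSpace ℝ 𝔽] (d : Fin n → ℝ) :
    Matrix (Fin n) (Fin n) 𝔽 :=
  Matrix.diagonal fun i => d i • (1 : 𝔽)

theorem nontrivial_of_isEuclideanStarRing (𝔽 : Type) [NormedRing 𝔽] [InnerProductSpace ℝ 𝔽]
    [StarRing 𝔽] [IsEuclideanStarRing 𝔽] : Nontrivial 𝔽 :=
  ⟨1, 0, fun h => by simpa [h] using IsEuclideanStarRing.inner_one_one' (𝔽 := 𝔽)⟩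

/-- An orthonormal family of fewer than `n` eigenvectors of a Hermitian matrix can be extended:
left multiplication by the matrix is a symmetric operator on the real space of the matrices whose
columns are orthogonal to the family, and a column of an eigenvector of this operator is a new
eigenvector. -/
theorem exists_eigenvector_orthogonal {A : Matrix (Fin n) (Fin n) 𝔽} (hA : A.IsHermitian) {k : ℕ}
    (hk : k < n) {v : Fin k → Fin n → 𝔽} {d : Fin k → ℝ} (hv : ∀ a, A *ᵥ v a = d a • v a) :
    ∃ (u : Fin n → 𝔽) (μ : ℝ), star u ⬝ᵥ u = 1 ∧ (∀ a, star (v a) ⬝ᵥ u = 0) ∧ A *ᵥ u = μ • u := by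
  have := nontrivial_of_isEuclideanStarRing 𝔽
  let T : Matrix (Fin n) (Fin n) 𝔽 →ₗ[ℝ] (Fin k → Fin n → 𝔽) :=
    { toFun := fun X a => star (v a) ᵥ* X
      map_add' := fun X Y => funext fun a => Matrix.vecMul_add _ _ _
      map_smul' := fun r X => funext fun a => Matrix.vecMul_smul _ _ _ }
  have hvA : ∀ a, star (v a) ᵥ* A = d a • star (v a) := by
    intro a
    have h1 := congrArg star (hv a)
    rw [Matrix.star_mulVec, hA.eq] at h1
    rw [h1]
    ext i
    simp
  let L : Matrix (Fin n) (Fin n) 𝔽 →ₗ[ℝ] Matrix (Fin n) (Fin n) 𝔽 :=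
    { toFun := fun X => A * X
      map_add' := mul_add A
      map_smul' := fun r X => mul_smul_matrix r A X }
  have hL : L.IsSymmetric := fun X Y => by
    change ⟪A * X, Y⟫_ℝ = ⟪X, A * Y⟫_ℝ
    rw [inner_mul_left, hA.eq]
  have hinv : ∀ X ∈ LinearMap.ker T, L X ∈ LinearMap.ker T := by
    intro X hX
    rw [LinearMap.mem_ker] at hX ⊢
    funext a
    change star (v a) ᵥ* (A * X) = 0
    rw [← Matrix.vecMul_vecMul, hvA, Matrix.smul_vecMul, show star (v a) ᵥ* X = 0 from
      congrFun hX a, smul_zero]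
  have hsymm := hL.restrict_invariant hinv
  have hker : LinearMap.ker T ≠ ⊥ := by
    refine LinearMap.ker_ne_bot_of_finrank_lt ?_
    have h1 : Module.finrank ℝ (Matrix (Fin n) (Fin n) 𝔽) = n * n * Module.finrank ℝ 𝔽 := by
      simpa using Module.finrank_matrix ℝ 𝔽 (Fin n) (Fin n)
    have h2 : Module.finrank ℝ (Fin k → Fin n → 𝔽) = k * n * Module.finrank ℝ 𝔽 := by
      simp [Module.finrank_pi_fintype, mul_assoc]
    have h3 : 0 < Module.finrank ℝ 𝔽 := Module.finrank_pos
    rw [h1, h2]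
    have : k * n < n * n := Nat.mul_lt_mul_of_pos_right hk (by omega)
    exact Nat.mul_lt_mul_of_pos_right this h3
  have : Nontrivial (LinearMap.ker T) := Submodule.nontrivial_iff_ne_bot.2 hker
  have hpos : 0 < Module.finrank ℝ (LinearMap.ker T) := Module.finrank_pos
  let b := hsymm.eigenvectorBasis rfl
  let i₀ : Fin (Module.finrank ℝ (LinearMap.ker T)) := ⟨0, hpos⟩
  obtain ⟨X, μ, hX0, hXT, hAX⟩ : ∃ (X : Matrix (Fin n) (Fin n) 𝔽) (μ : ℝ), X ≠ 0 ∧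
      X ∈ LinearMap.ker T ∧ A * X = μ • X := by
    refine ⟨b i₀, hsymm.eigenvalues rfl i₀, ?_, (b i₀).2, ?_⟩
    · exact fun h => b.orthonormal.ne_zero i₀ (Subtype.ext h)
    · exact congrArg Subtype.val (hsymm.apply_eigenvectorBasis rfl i₀)
  obtain ⟨i, j, hij⟩ : ∃ i j, X i j ≠ 0 := by
    by_contra! h
    exact hX0 (Matrix.ext h)
  -- normalize the `j`-th column
  let w : Fin n → 𝔽 := fun i => X i j
  set N : ℝ := ∑ i, ‖w i‖ ^ 2 with hN
  have hNpos : 0 < N := Finset.sum_pos' (fun _ _ => by positivity)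
    ⟨i, Finset.mem_univ _, by have := norm_pos_iff.2 hij; positivity⟩
  have hww : star w ⬝ᵥ w = N • (1 : 𝔽) := by
    rw [hN, Finset.sum_smul]
    exact Finset.sum_congr rfl fun i _ => star_mul_self_eq (w i)
  refine ⟨(√N)⁻¹ • w, μ, ?_, fun a => ?_, ?_⟩
  · rw [star_smul, star_trivial, smul_dotProduct, dotProduct_smul, hww, smul_smul, smul_smul]
    have : (√N)⁻¹ * (√N)⁻¹ * N = 1 := by
      have h1 := Real.mul_self_sqrt hNpos.le
      have h2 := (Real.sqrt_pos.2 hNpos).ne'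
      field_simp
      rw [sq, h1]
    rw [this, one_smul]
  · rw [dotProduct_smul]
    have h1 : star (v a) ⬝ᵥ w = 0 := congrFun (congrFun (LinearMap.mem_ker.1 hXT) a) j
    rw [h1, smul_zero]
  · rw [Matrix.mulVec_smul, smul_comm]
    congr 1
    funext i
    exact congrFun (congrFun hAX i) j

theorem exists_orthonormal_eigenvectors {A : Matrix (Fin n) (Fin n) 𝔽} (hA : A.IsHermitian) {k : ℕ}
    (hk : k ≤ n) : ∃ (v : Fin k → Fin n → 𝔽) (d : Fin k → ℝ), (∀ a, A *ᵥ v a = d a • v a) ∧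
      ∀ a b, star (v a) ⬝ᵥ v b = (1 : Matrix (Fin k) (Fin k) 𝔽) a b := by
  induction k with
  | zero => exact ⟨Fin.elim0, Fin.elim0, fun a => a.elim0, fun a => a.elim0⟩
  | succ k ih =>
    obtain ⟨v, d, hv, hort⟩ := ih (by omega)
    obtain ⟨u, μ, hu1, hu2, hu3⟩ := exists_eigenvector_orthogonal hA hk hv
    have hu2' : ∀ a, star u ⬝ᵥ v a = 0 := fun a => by
      rw [← star_star (v a), Matrix.star_dotProduct_star, hu2, star_zero]
    refine ⟨Fin.snoc v u, Fin.snoc d μ, fun a => ?_, fun a b => ?_⟩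
    · refine Fin.lastCases ?_ (fun a => ?_) a
      · simpa using hu3
      · simpa using hv a
    · refine Fin.lastCases ?_ (fun a => ?_) a <;> refine Fin.lastCases ?_ (fun b => ?_) b
      · simpa using hu1
      · simpa [Matrix.one_apply, Fin.ext_iff, b.2.ne'] using hu2' b
      · simpa [Matrix.one_apply, Fin.ext_iff, a.2.ne] using hu2 a
      · simpa [Matrix.one_apply, Fin.ext_iff] using hort a b

theorem mul_eq_one_comm_matrix {U U' : Matrix (Fin n) (Fin n) 𝔽} (h : U' * U = 1) : U * U' = 1 := by
  let L : Matrix (Fin n) (Fin n) 𝔽 → Module.End ℝ (Matrix (Fin n) (Fin n) 𝔽) := fun Y =>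
    { toFun := fun X => Y * X
      map_add' := mul_add Y
      map_smul' := fun r X => mul_smul_matrix r Y X }
  have h1 : L U' * L U = 1 := LinearMap.ext fun X => by
    change U' * (U * X) = X
    rw [← mul_assoc, h, one_mul]
  have h2 : U * (U' * 1) = 1 := LinearMap.congr_fun (mul_eq_one_comm.1 h1) 1
  rwa [mul_one] at h2

/-- The spectral theorem over `𝔽`. -/
theorem exists_unitary_diagonalization {A : Matrix (Fin n) (Fin n) 𝔽} (hA : A.IsHermitian) :
    ∃ (U : Matrix (Fin n) (Fin n) 𝔽) (d : Fin n → ℝ), Uᴴ * U = 1 ∧ U * Uᴴ = 1 ∧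
      A * U = U * realDiagonal n 𝔽 d := by
  obtain ⟨v, d, hv, hort⟩ := exists_orthonormal_eigenvectors hA le_rfl
  have h1 : (Matrix.of fun i a => v a i)ᴴ * (Matrix.of fun i a => v a i) = 1 := by
    ext a b
    exact hort a b
  refine ⟨Matrix.of fun i a => v a i, d, h1, mul_eq_one_comm_matrix h1, ?_⟩
  ext i a
  rw [realDiagonal, Matrix.mul_diagonal]
  have h2 : (A *ᵥ v a) i = d a • v a i := congrFun (hv a) i
  rw [Matrix.of_apply, mul_smul_comm, mul_one, ← h2]
  rfl

end Spectral

end HermitianMatrices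

/-! ### Matrices with symmetric spectrum -/

namespace HermitianMatrices

open SubmanifoldGeometry

section Symmetric

variable {n : ℕ} {𝔽 : Type} [NormedRing 𝔽] [InnerProductSpace ℝ 𝔽] [StarRing 𝔽]
  [IsEuclideanStarRing 𝔽]

theorem pow_mul_eq_of_mul_eq {A U : Matrix (Fin n) (Fin n) 𝔽} {d : Fin n → ℝ}
    (h : A * U = U * realDiagonal n 𝔽 d) (k : ℕ) :
    A ^ k * U = U * realDiagonal n 𝔽 fun i => d i ^ k := by
  induction k with
  | zero => simp [realDiagonal]
  | succ k ih =>
    rw [pow_succ', mul_assoc, ih, ← mul_assoc, h, mul_assoc, realDiagonal, realDiagonal,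
      realDiagonal, Matrix.diagonal_mul_diagonal]
    congr 2
    funext i
    rw [smul_mul_smul_comm, mul_one, pow_succ']

variable [FiniteDimensional ℝ 𝔽]

/-- A Hermitian matrix whose odd power sums vanish up to the exponent `n` has a symmetric spectrum; so
it is unitarily conjugate to its negative. With `p = (n - 1) / 2`, the squares of its eigenvalues
take `p + 1` values at most, so `A ^ (2 * (p + 1))` is a combination of the smaller even powers. -/
theorem exists_unitary_conj_eq_neg {A : Matrix (Fin n) (Fin n) 𝔽} (hA : A.IsHermitian)
    (hodd : ∀ k, Odd k → k ≤ n → ⟪1, A ^ k⟫_ℝ = 0) :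
    (∃ R : Matrix (Fin n) (Fin n) 𝔽, Rᴴ * R = 1 ∧ R * Rᴴ = 1 ∧ R * A * Rᴴ = -A) ∧
    (0 < n → ∃ c : Fin ((n - 1) / 2 + 1) → ℝ,
      A ^ (2 * ((n - 1) / 2 + 1)) = ∑ a, c a • A ^ (2 * (a : ℕ))) := by
  obtain ⟨U, d, hU, hU', hAU⟩ := exists_unitary_diagonalization hA
  have hpow : ∀ k, A ^ k = U * (realDiagonal n 𝔽 fun i => d i ^ k) * Uᴴ := fun k => by
    rw [← pow_mul_eq_of_mul_eq hAU, mul_assoc, hU', mul_one]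
  have hsym : IsSignSymmetric d := by
    refine isSignSymmetric_of_sum_odd_pow fun k hk hkn => ?_
    rw [← hodd k hk hkn, hpow, real_inner_comm, inner_mul_right, inner_mul_left, one_mul,
      Matrix.conjTranspose_conjTranspose, hU, real_inner_comm, inner_one_left, realDiagonal,
      Matrix.trace_diagonal, inner_sum]
    refine Finset.sum_congr rfl fun i _ => ?_
    rw [inner_smul_right, IsEuclideanStarRing.inner_one_one', mul_one]
  refine ⟨?_, fun hn => ?_⟩
  · obtain ⟨σ, hσ⟩ := hsym
    -- `T` has the columns of `U` in the order that exchanges the eigenvalues `d i` and `-d i`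
    let T : Matrix (Fin n) (Fin n) 𝔽 := U.submatrix id σ
    have hTT : Tᴴ * T = 1 := by
      rw [show Tᴴ = Uᴴ.submatrix σ id from rfl,
        ← Matrix.submatrix_mul _ _ σ id σ Function.bijective_id, hU, Matrix.submatrix_one_equiv]
    have hAT : A * T = -(T * realDiagonal n 𝔽 d) := by
      ext i j
      have h1 := congrFun (congrFun hAU i) (σ j)
      rw [realDiagonal, Matrix.mul_diagonal, hσ] at h1
      rw [Matrix.neg_apply, realDiagonal, Matrix.mul_diagonal]
      have h2 : (A * T) i j = (A * U) i (σ j) := rfl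
      rw [h2, h1, neg_smul, mul_neg]
      rfl
    have hTT' := mul_eq_one_comm_matrix hTT
    have hUA : Uᴴ * A = realDiagonal n 𝔽 d * Uᴴ := by
      have h1 := congrArg (fun X => Uᴴ * X * Uᴴ) hAU
      simp only [mul_assoc, hU', mul_one] at h1
      rw [h1, ← mul_assoc, hU, one_mul]
    refine ⟨T * Uᴴ, ?_, ?_, ?_⟩
    · rw [Matrix.conjTranspose_mul, Matrix.conjTranspose_conjTranspose, mul_assoc,
        ← mul_assoc Tᴴ, hTT, one_mul, hU']
    · rw [Matrix.conjTranspose_mul, Matrix.conjTranspose_conjTranspose, mul_assoc,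
        ← mul_assoc Uᴴ, hU, one_mul, hTT']
    · rw [Matrix.conjTranspose_mul, Matrix.conjTranspose_conjTranspose, mul_assoc T, hUA,
        mul_assoc T, mul_assoc (realDiagonal n 𝔽 d), ← mul_assoc Uᴴ, hU, one_mul, ← mul_assoc,
        ← neg_eq_iff_eq_neg.2 hAT, neg_mul, mul_assoc, hTT', mul_one]
  · obtain ⟨c, hc⟩ := exists_pow_eq_sum _ (card_image_sq_le hn hsym)
    refine ⟨c, ?_⟩
    simp only [hpow]
    have h1 : (realDiagonal n 𝔽 fun i => d i ^ (2 * ((n - 1) / 2 + 1))) =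
        ∑ a, c a • realDiagonal n 𝔽 fun i => d i ^ (2 * (a : ℕ)) := by
      simp only [realDiagonal]
      ext i j
      rw [Matrix.sum_apply]
      by_cases hij : i = j
      · subst hij
        simp only [Matrix.smul_apply, Matrix.diagonal_apply_eq, smul_smul, pow_mul]
        rw [hc _ (Finset.mem_image_of_mem _ (Finset.mem_univ i)), Finset.sum_smul]
      · simp [hij]
    rw [h1, Finset.mul_sum, Finset.sum_mul]
    exact Finset.sum_congr rfl fun a _ => by rw [mul_smul_matrix, smul_mul_matrix]

end Symmetric

end HermitianMatrices

/-! ### The operators `powDeriv`, and the dimension of the space of Hermitian matrices -/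

namespace HermitianMatrices

open SubmanifoldGeometry

section PowDeriv

variable {n : ℕ} {𝔽 : Type} [NormedRing 𝔽] [InnerProductSpace ℝ 𝔽] [StarRing 𝔽]
  [IsEuclideanStarRing 𝔽]

theorem inner_powDeriv_left {A : Matrix (Fin n) (Fin n) 𝔽} (hA : A.IsHermitian) (k : ℕ)
    (X Y : Matrix (Fin n) (Fin n) 𝔽) : ⟪powDeriv k A X, Y⟫_ℝ = ⟪X, powDeriv k A Y⟫_ℝ := by
  rw [powDeriv_apply, powDeriv_apply, sum_inner, inner_sum]
  refine Finset.sum_congr rfl fun i _ => ?_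
  rw [inner_mul_right, inner_mul_left, (hA.pow _).eq, (hA.pow _).eq, mul_assoc]

theorem isHermitian_powDeriv {A X : Matrix (Fin n) (Fin n) 𝔽} (hA : A.IsHermitian)
    (hX : X.IsHermitian) (k : ℕ) : (powDeriv k A X).IsHermitian := by
  rw [Matrix.IsHermitian, powDeriv_apply, Matrix.conjTranspose_sum, ← Finset.sum_range_reflect]
  refine Finset.sum_congr rfl fun i hi => ?_
  have hi' := Finset.mem_range.1 hi
  rw [Matrix.conjTranspose_mul, Matrix.conjTranspose_mul, (hA.pow _).eq, (hA.pow _).eq, hX.eq,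
    mul_assoc]
  congr 2
  omega

theorem powDeriv_pow (k j : ℕ) (A : Matrix (Fin n) (Fin n) 𝔽) :
    powDeriv k A (A ^ j) = (k : ℝ) • A ^ (k - 1 + j) := by
  rw [powDeriv_apply]
  have h : ∀ i ∈ Finset.range k, A ^ i * A ^ j * A ^ (k - 1 - i) = A ^ (k - 1 + j) := by
    intro i hi
    have hi' := Finset.mem_range.1 hi
    rw [← pow_add, ← pow_add]
    congr 1
    omega
  rw [Finset.sum_congr rfl h, Finset.sum_const, Finset.card_range, Nat.cast_smul_eq_nsmul]

theorem powDeriv_comm (k l : ℕ) (A X : Matrix (Fin n) (Fin n) 𝔽) :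
    powDeriv k A (powDeriv l A X) = powDeriv l A (powDeriv k A X) := by
  simp only [powDeriv_apply, Finset.mul_sum, Finset.sum_mul]
  rw [Finset.sum_comm]
  refine Finset.sum_congr rfl fun j _ => Finset.sum_congr rfl fun i _ => ?_
  have h1 : A ^ i * (A ^ j * X * A ^ (l - 1 - j)) * A ^ (k - 1 - i) =
      (A ^ i * A ^ j) * X * (A ^ (l - 1 - j) * A ^ (k - 1 - i)) := by simp only [mul_assoc]
  have h2 : A ^ j * (A ^ i * X * A ^ (k - 1 - i)) * A ^ (l - 1 - j) =
      (A ^ j * A ^ i) * X * (A ^ (k - 1 - i) * A ^ (l - 1 - j)) := by simp only [mul_assoc]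
  rw [h1, h2, pow_mul_comm A i j, pow_mul_comm A (l - 1 - j)]

/-- Conjugation by a unitary matrix that maps `A` to `-A` reverses the sign of the odd homogeneous
operator `powDeriv (2 * k) A`. -/
theorem powDeriv_conj_of_anticommute {A R : Matrix (Fin n) (Fin n) 𝔽}
    (hAR : A * R = -(R * A)) (hRA : Rᴴ * A = -(A * Rᴴ)) (k : ℕ) (X : Matrix (Fin n) (Fin n) 𝔽) :
    powDeriv (2 * k) A (R * X * Rᴴ) = -(R * powDeriv (2 * k) A X * Rᴴ) := by
  have h1 : ∀ i, A ^ i * R = R * (-A) ^ i := fun i =>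
    ((show SemiconjBy R (-A) A by rw [SemiconjBy, hAR, mul_neg]).pow_right i).symm
  have h2 : ∀ i, Rᴴ * A ^ i = (-A) ^ i * Rᴴ := fun i =>
    (show SemiconjBy Rᴴ A (-A) by rw [SemiconjBy, hRA, neg_mul]).pow_right i
  simp only [powDeriv_apply, Finset.mul_sum, Finset.sum_mul, ← Finset.sum_neg_distrib]
  refine Finset.sum_congr rfl fun i hi => ?_
  have hi' := Finset.mem_range.1 hi
  have h3 : A ^ i * (R * X * Rᴴ) * A ^ (2 * k - 1 - i) =
      (A ^ i * R) * X * (Rᴴ * A ^ (2 * k - 1 - i)) := by simp only [mul_assoc]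
  rw [h3, h1, h2]
  rcases Nat.even_or_odd i with he | ho
  · have ho' : Odd (2 * k - 1 - i) := by
      obtain ⟨m, rfl⟩ := he
      exact ⟨k - 1 - m, by omega⟩
    rw [he.neg_pow, ho'.neg_pow]
    simp only [mul_assoc, neg_mul, mul_neg]
  · have he' : Even (2 * k - 1 - i) := by
      obtain ⟨m, rfl⟩ := ho
      exact ⟨k - 1 - m, by omega⟩
    rw [ho.neg_pow, he'.neg_pow]
    simp only [mul_assoc, neg_mul, mul_neg]

theorem inner_one_powDeriv {A : Matrix (Fin n) (Fin n) 𝔽} (hA : A.IsHermitian) (k : ℕ)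
    (X : Matrix (Fin n) (Fin n) 𝔽) : ⟪1, powDeriv k A X⟫_ℝ = k * ⟪A ^ (k - 1), X⟫_ℝ := by
  rw [← inner_powDeriv_left hA, ← pow_zero A, powDeriv_pow, real_inner_smul_left, add_zero]

end PowDeriv

section Dimension

variable (n : ℕ) (𝔽 : Type) [NormedRing 𝔽] [InnerProductSpace ℝ 𝔽] [StarRing 𝔽]
  [IsEuclideanStarRing 𝔽]

/-- The real vector space of Hermitian matrices. -/
noncomputable def hermitianSpace : Submodule ℝ (Matrix (Fin n) (Fin n) 𝔽) where
  carrier := {X | X.IsHermitian}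
  add_mem' hX hY := hX.add hY
  zero_mem' := Matrix.isHermitian_zero
  smul_mem' r X hX := by
    change (r • X)ᴴ = r • X
    ext i j
    have h1 : star (X j i) = X i j := congrFun (congrFun (Matrix.IsHermitian.eq hX) i) j
    rw [Matrix.conjTranspose_apply, Matrix.smul_apply, Matrix.smul_apply, star_smul, h1,
      star_trivial]

/-- The space `E(n, 𝔽)` of traceless Hermitian matrices: the Hermitian matrices orthogonal to the
unit matrix. -/
noncomputable def tracelessSpace : Submodule ℝ (Matrix (Fin n) (Fin n) 𝔽) :=
  hermitianSpace n 𝔽 ⊓ (Submodule.span ℝ {1})ᗮ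

variable {n 𝔽}

theorem mem_hermitianSpace {X : Matrix (Fin n) (Fin n) 𝔽} :
    X ∈ hermitianSpace n 𝔽 ↔ X.IsHermitian := Iff.rfl

theorem mem_tracelessSpace {X : Matrix (Fin n) (Fin n) 𝔽} :
    X ∈ tracelessSpace n 𝔽 ↔ X.IsHermitian ∧ ⟪1, X⟫_ℝ = 0 := by
  rw [tracelessSpace, Submodule.mem_inf, Submodule.mem_orthogonal_singleton_iff_inner_right]
  rfl

theorem inner_one_one_matrix : ⟪(1 : Matrix (Fin n) (Fin n) 𝔽), 1⟫_ℝ = n := by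
  rw [inner_one_left, Matrix.trace_one, Fintype.card_fin, ← nsmul_one, ← Nat.cast_smul_eq_nsmul ℝ,
    inner_smul_right, IsEuclideanStarRing.inner_one_one', mul_one]

variable [FiniteDimensional ℝ 𝔽]

/-- A Hermitian matrix is determined by its real diagonal and by its entries above the diagonal,
which are arbitrary. -/
theorem finrank_hermitianSpace :
    Module.finrank ℝ (hermitianSpace n 𝔽) = n + n * (n - 1) / 2 * Module.finrank ℝ 𝔽 := by
  let T : hermitianSpace n 𝔽 →ₗ[ℝ] (Fin n → ℝ) × (∀ j : Fin n, Fin j → 𝔽) :=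
    { toFun := fun X => (fun i => ⟪1, X.1 i i⟫_ℝ, fun j i => X.1 ⟨i, i.2.trans j.2⟩ j)
      map_add' := fun X Y => by
        refine Prod.ext (funext fun i => inner_add_right _ _ _) rfl
      map_smul' := fun r X => by
        refine Prod.ext (funext fun i => inner_smul_right _ _ _) rfl }
  have hinj : Function.Injective T := by
    rw [injective_iff_map_eq_zero]
    intro X hX
    have hupper : ∀ i j : Fin n, i < j → X.1 i j = 0 := fun i j hij =>
      congrFun (congrFun (congrArg Prod.snd hX) j) ⟨i, hij⟩
    have hstar : ∀ i j, star (X.1 j i) = X.1 i j := fun i j =>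
      congrFun (congrFun (mem_hermitianSpace.1 X.2).eq i) j
    refine Subtype.ext (Matrix.ext fun i j => ?_)
    change X.1 i j = 0
    rcases lt_trichotomy i j with h | rfl | h
    · exact hupper i j h
    · have h1 : ⟪1, X.1 i i⟫_ℝ = 0 := congrFun (congrArg Prod.fst hX) i
      rw [IsEuclideanStarRing.eq_smul_one_of_star_eq _ (hstar i i), h1, zero_smul]
    · rw [← hstar, hupper j i h, star_zero]
  have hsurj : Function.Surjective T := by
    rintro ⟨d, z⟩
    let X : Matrix (Fin n) (Fin n) 𝔽 := Matrix.of fun i j =>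
      if h : i < j then z j ⟨i, h⟩ else if h : j < i then star (z i ⟨j, h⟩) else d i • 1
    have hX : X.IsHermitian := by
      ext i j
      rw [Matrix.conjTranspose_apply]
      rcases lt_trichotomy i j with h | rfl | h
      · simp [X, h, h.not_gt]
      · simp [X]
      · simp [X, h, h.not_gt]
    refine ⟨⟨X, hX⟩, Prod.ext (funext fun i => ?_) (funext fun j => funext fun i => ?_)⟩
    · change ⟪1, X i i⟫_ℝ = d i
      simp only [X, Matrix.of_apply, lt_irrefl, dite_false]
      rw [inner_smul_right, IsEuclideanStarRing.inner_one_one', mul_one]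
    · change X ⟨i, _⟩ j = z j i
      have h : (⟨i, i.2.trans j.2⟩ : Fin n) < j := i.2
      simp [X, h]
  rw [(LinearEquiv.ofBijective T ⟨hinj, hsurj⟩).finrank_eq, Module.finrank_prod,
    Module.finrank_fin_fun, Module.finrank_pi_fintype]
  congr 1
  have h1 : ∀ j : Fin n, Module.finrank ℝ (Fin j → 𝔽) = j * Module.finrank ℝ 𝔽 := fun j => by
    simp [Module.finrank_pi_fintype]
  simp only [h1]
  rw [← Finset.sum_mul, Fin.sum_univ_eq_sum_range (fun j => j) n, Finset.sum_range_id]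

theorem finrank_tracelessSpace (hn : 0 < n) :
    Module.finrank ℝ (tracelessSpace n 𝔽) = dimE n 𝔽 := by
  have hone : ⟪(1 : Matrix (Fin n) (Fin n) 𝔽), 1⟫_ℝ ≠ 0 := by
    rw [inner_one_one_matrix]
    exact_mod_cast hn.ne'
  have h1ne : (1 : Matrix (Fin n) (Fin n) 𝔽) ≠ 0 := fun h => hone (by rw [h, inner_zero_left])
  have hle : Submodule.span ℝ {(1 : Matrix (Fin n) (Fin n) 𝔽)} ≤ hermitianSpace n 𝔽 :=
    (Submodule.span_singleton_le_iff_mem _ _).2 Matrix.isHermitian_one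
  have h2 := Submodule.finrank_add_inf_finrank_orthogonal hle
  rw [finrank_span_singleton h1ne, inf_comm] at h2
  have h3 : Module.finrank ℝ (tracelessSpace n 𝔽) + 1 = Module.finrank ℝ (hermitianSpace n 𝔽) := by
    rw [tracelessSpace, ← h2, add_comm]
  rw [finrank_hermitianSpace] at h3
  rw [dimE]
  omega

end Dimension

end HermitianMatrices

/-! ### `S` and `B` as level sets -/

namespace HermitianMatrices

open SubmanifoldGeometry

section LevelSets

theorem B_subset_S {n : ℕ} {𝔽 : Type} [NormedRing 𝔽] [InnerProductSpace ℝ 𝔽] [StarRing 𝔽] :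
    B n 𝔽 ⊆ S n 𝔽 := fun _ h => h.1

variable {n : ℕ} {𝔽 : Type} [NormedRing 𝔽] [InnerProductSpace ℝ 𝔽] [StarRing 𝔽]
  [IsEuclideanStarRing 𝔽] [FiniteDimensional ℝ 𝔽]

theorem S_eq_regularZeros : S n 𝔽 = regularZeros (sphereMap (tracelessSpace n 𝔽)) := by
  ext A
  rw [mem_regularZeros_sphereMap, mem_tracelessSpace, and_assoc]
  exact and_congr_right fun h1 => and_congr_left' (trace_eq_zero_iff h1)

theorem mem_tangentSpace_S {A : Matrix (Fin n) (Fin n) 𝔽} (hA : A ∈ S n 𝔽)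
    {v : Matrix (Fin n) (Fin n) 𝔽} :
    v ∈ tangentSpace (S n 𝔽) A ↔ v.IsHermitian ∧ ⟪1, v⟫_ℝ = 0 ∧ ⟪A, v⟫_ℝ = 0 := by
  rw [S_eq_regularZeros] at hA ⊢
  rw [mem_tangentSpace_sphereMap hA, mem_tracelessSpace, and_assoc]

theorem hasFDerivAt_f (k : ℕ) (A : Matrix (Fin n) (Fin n) 𝔽) :
    HasFDerivAt (f n 𝔽 k) (innerSL ℝ 1 ∘L LinearMap.toContinuousLinearMap (powDeriv k A)) A := by
  have h1 : f n 𝔽 k = fun X => innerSL ℝ 1 (X ^ k) := funext fun X => f_eq_inner k X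
  rw [h1]
  exact (innerSL ℝ (1 : Matrix (Fin n) (Fin n) 𝔽)).hasFDerivAt.comp A (hasFDerivAt_pow k A)

theorem contDiff_f (k : ℕ) : ContDiff ℝ ∞ (f n 𝔽 k) := by
  have h1 : f n 𝔽 k = fun X => innerSL ℝ 1 (X ^ k) := funext fun X => f_eq_inner k X
  rw [h1]
  exact (innerSL ℝ (1 : Matrix (Fin n) (Fin n) 𝔽)).contDiff.comp (contDiff_pow_matrix k)

theorem contDiff_Φ : ContDiff ℝ ∞ (Φ n 𝔽) :=
  contDiff_pi.2 fun _ => contDiff_f _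

theorem B_eq_regularZeros :
    B n 𝔽 = regularZeros fun A => (sphereMap (tracelessSpace n 𝔽) A, Φ n 𝔽 A) := by
  ext A
  rw [mem_regularZeros_prod (contDiff_sphereMap _) contDiff_Φ, ← S_eq_regularZeros]
  rfl

theorem isSubmanifold_B (hn : 3 ≤ n) : IsSubmanifold (B n 𝔽) (dimE n 𝔽 - (n - 1) / 2 - 1) := by
  have := nontrivial_of_isEuclideanStarRing 𝔽
  rw [B_eq_regularZeros]
  refine isSubmanifold_regularZeros ((contDiff_sphereMap _).prodMk contDiff_Φ) ?_
  rw [Module.finrank_prod, Module.finrank_prod, Module.finrank_self, Module.finrank_fin_fun]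
  have h1 := Submodule.finrank_add_finrank_orthogonal (tracelessSpace n 𝔽)
  rw [finrank_tracelessSpace (by omega)] at h1
  have h2 : (n - 1) / 2 + 1 ≤ dimE n 𝔽 := by
    rw [dimE]
    omega
  omega

variable {A : Matrix (Fin n) (Fin n) 𝔽}

/-- On `B` the gradient of `f_k`, for `k = 2 * a + 3`, is the traceless part of `k • A ^ (k - 1)`; its
radial part vanishes with `f_k`. -/
theorem gradField_eq (hA : A ∈ B n 𝔽) (hn : 0 < n) (a : Fin ((n - 1) / 2)) :
    gradField n 𝔽 a A = ((2 * a + 3 : ℕ) : ℝ) •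
      (A ^ (2 * (a : ℕ) + 2) - ((n : ℝ)⁻¹ * ⟪1, A ^ (2 * (a : ℕ) + 2)⟫_ℝ) • 1) := by
  have hh := hA.1.1
  have hS1 : ⟪1, A⟫_ℝ = 0 := (trace_eq_zero_iff hh).1 hA.1.2.1
  have hf : ⟪A, A ^ (2 * (a : ℕ) + 2)⟫_ℝ = 0 := by
    have h1 : f n 𝔽 (2 * a + 3) A = 0 := congrFun hA.2.1 a
    rw [f_eq_inner] at h1
    rw [pow_succ' A (2 * a + 2), ← hh.eq, ← inner_mul_left, mul_one, hh.eq] at h1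
    exact h1
  have hn' : (n : ℝ) ≠ 0 := by exact_mod_cast hn.ne'
  refine grad_eq (hasFDerivAt_f _ A).hasFDerivWithinAt ?_ fun v hv => ?_
  · rw [mem_tangentSpace_S hA.1]
    refine ⟨?_, ?_, ?_⟩
    · have h1 : A ^ (2 * (a : ℕ) + 2) ∈ hermitianSpace n 𝔽 := hh.pow _
      have h2 : (1 : Matrix (Fin n) (Fin n) 𝔽) ∈ hermitianSpace n 𝔽 := Matrix.isHermitian_one
      exact Submodule.smul_mem _ _ (Submodule.sub_mem _ h1 (Submodule.smul_mem _ _ h2))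
    · rw [inner_smul_right, inner_sub_right, inner_smul_right, inner_one_one_matrix]
      field_simp
      ring
    · rw [inner_smul_right, inner_sub_right, inner_smul_right, hf, real_inner_comm 1 A, hS1]
      ring
  · obtain ⟨-, h1, -⟩ := (mem_tangentSpace_S hA.1).1 hv
    rw [real_inner_smul_left, inner_sub_left, real_inner_smul_left, h1]
    change _ = ⟪1, powDeriv _ A v⟫_ℝ
    rw [inner_one_powDeriv hh]
    simp

theorem isNormalFrame_gradField (hn : 0 < n) :
    IsNormalFrame (S n 𝔽) (B n 𝔽) (gradField n 𝔽) := by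
  have h1 := isNormalFrame_grad (contDiff_sphereMap (tracelessSpace n 𝔽)) (contDiff_Φ (n := n) (𝔽 := 𝔽)) ?_
  · rwa [← S_eq_regularZeros, ← B_eq_regularZeros] at h1
  · intro a
    rw [← S_eq_regularZeros, ← B_eq_regularZeros]
    have h2 : ContDiff ℝ ∞ fun A : Matrix (Fin n) (Fin n) 𝔽 => ((2 * a + 3 : ℕ) : ℝ) •
        (A ^ (2 * (a : ℕ) + 2) - ((n : ℝ)⁻¹ * ⟪1, A ^ (2 * (a : ℕ) + 2)⟫_ℝ) • (1 : Matrix _ _ 𝔽)) :=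
      ((contDiff_pow_matrix _).sub ((contDiff_const.mul
        (contDiff_const.inner ℝ (contDiff_pow_matrix _))).smul contDiff_const)).const_smul _
    exact h2.contDiffOn.congr fun A hA => gradField_eq hA hn a

end LevelSets

end HermitianMatrices

/-! ### The shape operators of `B` -/

namespace SubmanifoldGeometry

section Austere

variable {V : Type*} [NormedAddCommGroup V] [InnerProductSpace ℝ V] [FiniteDimensional ℝ V]

theorem simultaneouslyDiagonalizableSymmetric_of_anticommute {T : Type*} [NormedAddCommGroup T]
    [InnerProductSpace ℝ T] [FiniteDimensional ℝ T] {A : Type*} {S : A → T →ₗ[ℝ] T}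
    (hS : ∀ a, (S a).IsSymmetric) (hc : ∀ a b, Commute (S a) (S b)) (J : T ≃ₗ[ℝ] T)
    (hJ : ∀ a v, J (S a v) = -S a (J v)) : SimultaneouslyDiagonalizableSymmetric S := by
  obtain ⟨b, κ, h⟩ := exists_orthonormalBasis_joint_eigenvectors hS hc
  exact ⟨b, κ, h, fun a => isSignSymmetric_of_anticommute J (hJ a) b.toBasis (by simpa using h a)⟩

theorem isAustere_of_anticommute {M N : Set V} (hMN : M ⊆ N) {k : ℕ} {ν : Fin k → V → V}
    (hν : IsNormalFrame N M ν)
    (hS : ∀ x ∈ M, ∀ a, (shapeOperator N M (ν a) x).IsSymmetric)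
    (hJ : ∀ x ∈ M, ∃ J : tangentSpace M x ≃ₗ[ℝ] tangentSpace M x, ∀ a v,
      J (shapeOperator N M (ν a) x v) = -shapeOperator N M (ν a) x (J v)) : IsAustere N M := by
  intro ξ hξ x hx
  obtain ⟨c, hc⟩ := exists_shapeOperator_eq_sum hMN hν hξ hx
  obtain ⟨J, hJ⟩ := hJ x hx
  have hsym : (shapeOperator N M ξ x).IsSymmetric := by
    intro v w
    simp only [hc, LinearMap.sum_apply, LinearMap.smul_apply, sum_inner, inner_sum,
      real_inner_smul_left, real_inner_smul_right]
    exact Finset.sum_congr rfl fun a _ => by rw [hS x hx a v w]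
  have hJξ : ∀ v, J (shapeOperator N M ξ x v) = -shapeOperator N M ξ x (J v) := by
    intro v
    simp only [hc, LinearMap.sum_apply, LinearMap.smul_apply, map_sum, map_smul, hJ, smul_neg,
      Finset.sum_neg_distrib]
  exact ⟨hsym.eigenvectorBasis rfl, hsym.eigenvalues rfl, hsym.apply_eigenvectorBasis rfl,
    isSignSymmetric_of_anticommute J hJξ (hsym.eigenvectorBasis rfl).toBasis
      (by simp)⟩

end Austere

end SubmanifoldGeometry

namespace HermitianMatrices

open SubmanifoldGeometry

section ShapeOperators

variable {n : ℕ} {𝔽 : Type} [NormedRing 𝔽] [InnerProductSpace ℝ 𝔽] [StarRing 𝔽]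
  [IsEuclideanStarRing 𝔽] {A : Matrix (Fin n) (Fin n) 𝔽}

theorem inner_one_odd_pow_of_le (hA : A ∈ B n 𝔽) {k : ℕ} (hk : Odd k) (hkn : k ≤ n) :
    ⟪1, A ^ k⟫_ℝ = 0 := by
  obtain ⟨j, rfl⟩ := hk
  rcases j with _ | j
  · rw [mul_zero, zero_add, pow_one]
    exact (trace_eq_zero_iff hA.1.1).1 hA.1.2.1
  · have h1 : f n 𝔽 (2 * j + 3) A = 0 := congrFun hA.2.1 ⟨j, by omega⟩
    rwa [f_eq_inner] at h1

theorem conj_pow_eq_neg_pow {𝔽 : Type} [NormedRing 𝔽] [StarRing 𝔽]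
    {A R : Matrix (Fin n) (Fin n) 𝔽} (hR' : R * Rᴴ = 1)
    (hRA : Rᴴ * A = -(A * Rᴴ)) (k : ℕ) : R * A ^ k * Rᴴ = (-A) ^ k := by
  have h1 : A * Rᴴ = Rᴴ * (-A) := by rw [mul_neg, hRA, neg_neg]
  have h2 : Rᴴ * (-A) ^ k = A ^ k * Rᴴ := (show SemiconjBy Rᴴ (-A) A from h1.symm).pow_right k
  rw [mul_assoc, ← h2, ← mul_assoc, hR', one_mul]

theorem inner_pow_pow (hA : A.IsHermitian) (i j : ℕ) : ⟪A ^ i, A ^ j⟫_ℝ = ⟪1, A ^ (i + j)⟫_ℝ := by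
  have h := inner_mul_left (A ^ i) 1 (A ^ j)
  rwa [mul_one, (hA.pow i).eq, ← pow_add] at h

theorem inner_pow_powDeriv {u : Matrix (Fin n) (Fin n) 𝔽} (hA : A.IsHermitian)
    (hu : ∀ i, ⟪A ^ i, u⟫_ℝ = 0) (k i : ℕ) : ⟪A ^ i, powDeriv k A u⟫_ℝ = 0 := by
  rw [← inner_powDeriv_left hA, powDeriv_pow, real_inner_smul_left, hu, mul_zero]

variable [FiniteDimensional ℝ 𝔽]

theorem exists_unitary_of_mem_B (hA : A ∈ B n 𝔽) :
    ∃ R : Matrix (Fin n) (Fin n) 𝔽, Rᴴ * R = 1 ∧ R * Rᴴ = 1 ∧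
      A * R = -(R * A) ∧ Rᴴ * A = -(A * Rᴴ) := by
  obtain ⟨R, hR, hR', hRA⟩ := (exists_unitary_conj_eq_neg hA.1.1
    fun k hk hkn => inner_one_odd_pow_of_le hA hk hkn).1
  have h1 : R * A = -(A * R) := by
    rw [← neg_mul, ← hRA, mul_assoc, hR, mul_one]
  refine ⟨R, hR, hR', by rw [h1, neg_neg], ?_⟩
  have h2 := congrArg Matrix.conjTranspose h1
  rw [Matrix.conjTranspose_neg, Matrix.conjTranspose_mul, Matrix.conjTranspose_mul, hA.1.1.eq] at h2
  rw [h2, neg_neg]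

theorem inner_one_odd_pow (hA : A ∈ B n 𝔽) {k : ℕ} (hk : Odd k) : ⟪1, A ^ k⟫_ℝ = 0 := by
  obtain ⟨R, hR, hR', -, hRA⟩ := exists_unitary_of_mem_B hA
  have h1 : ⟪1, R * A ^ k * Rᴴ⟫_ℝ = ⟪1, A ^ k⟫_ℝ := by
    rw [real_inner_comm, inner_mul_right, inner_mul_left, Matrix.conjTranspose_conjTranspose,
      one_mul, hR, real_inner_comm]
  rw [conj_pow_eq_neg_pow hR' hRA, hk.neg_pow, inner_neg_right] at h1
  linarith

/-- All even powers of `A` are combinations of `1, A ^ 2, …, A ^ (2 * p)`, since the squares of the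
eigenvalues take `p + 1` values at most. So a tangent vector is orthogonal to all of them. -/
theorem mem_tangentSpace_B (hA : A ∈ B n 𝔽) (hn : 0 < n) {v : Matrix (Fin n) (Fin n) 𝔽} :
    v ∈ tangentSpace (B n 𝔽) A ↔ v.IsHermitian ∧ ⟪A, v⟫_ℝ = 0 ∧ ∀ j, ⟪A ^ (2 * j), v⟫_ℝ = 0 := by
  have h1 : v ∈ tangentSpace (B n 𝔽) A ↔ v ∈ tangentSpace (S n 𝔽) A ∧
      ∀ a, ⟪gradField n 𝔽 a A, v⟫_ℝ = 0 := by
    have hA' := hA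
    rw [B_eq_regularZeros] at hA'
    have h2 := mem_tangentSpace_prod_iff (contDiff_sphereMap (tracelessSpace n 𝔽))
      (contDiff_Φ (n := n) (𝔽 := 𝔽)) hA' (v := v)
    rwa [← B_eq_regularZeros, ← S_eq_regularZeros] at h2
  have hg : ⟪1, v⟫_ℝ = 0 → ∀ a : Fin ((n - 1) / 2), ⟪gradField n 𝔽 a A, v⟫_ℝ = 0 ↔
      ⟪A ^ (2 * (a : ℕ) + 2), v⟫_ℝ = 0 := by
    intro hv a
    have h0 : ((2 * (a : ℕ) + 3 : ℕ) : ℝ) ≠ 0 := by positivity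
    rw [gradField_eq hA hn, real_inner_smul_left, inner_sub_left, real_inner_smul_left, hv,
      mul_zero, sub_zero, mul_eq_zero_iff_left h0]
  rw [h1, mem_tangentSpace_S hA.1]
  constructor
  · rintro ⟨⟨hv, hv1, hvA⟩, hva⟩
    refine ⟨hv, hvA, fun j => ?_⟩
    obtain ⟨c, hc⟩ := (exists_unitary_conj_eq_neg hA.1.1
      fun k hk hkn => inner_one_odd_pow_of_le hA hk hkn).2 hn
    induction j using Nat.strong_induction_on with
    | _ j ih =>
      rcases Nat.eq_zero_or_pos j with rfl | hj
      · simpa using hv1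
      by_cases hjp : j ≤ (n - 1) / 2
      · have h3 := (hg hv1 ⟨j - 1, by omega⟩).1 (hva _)
        have h4 : 2 * (j - 1) + 2 = 2 * j := by omega
        rwa [h4] at h3
      · have h3 : A ^ (2 * j) = ∑ a, c a • A ^ (2 * (j - ((n - 1) / 2 + 1) + (a : ℕ))) := by
          have h4 : 2 * j = 2 * (j - ((n - 1) / 2 + 1)) + 2 * ((n - 1) / 2 + 1) := by omega
          rw [h4, pow_add, hc, Finset.mul_sum]
          refine Finset.sum_congr rfl fun a _ => ?_
          rw [mul_smul_matrix, ← pow_add, mul_add]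
        rw [h3, sum_inner]
        refine Finset.sum_eq_zero fun a _ => ?_
        rw [real_inner_smul_left, ih _ (by omega), mul_zero]
  · rintro ⟨hv, hvA, hj⟩
    have hv1 : ⟪1, v⟫_ℝ = 0 := by simpa using hj 0
    exact ⟨⟨hv, hv1, hvA⟩, fun a => (hg hv1 a).2 (hj (a + 1))⟩

theorem fderivWithin_gradField (hA : A ∈ B n 𝔽) (hn : 0 < n) (a : Fin ((n - 1) / 2))
    {v : Matrix (Fin n) (Fin n) 𝔽} (hv : v ∈ tangentSpace (B n 𝔽) A) :
    fderivWithin ℝ (gradField n 𝔽 a) (B n 𝔽) A v = ((2 * a + 3 : ℕ) : ℝ) •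
      (powDeriv (2 * a + 2) A v - ((n : ℝ)⁻¹ * ⟪1, powDeriv (2 * a + 2) A v⟫_ℝ) • 1) := by
  let L : Matrix (Fin n) (Fin n) 𝔽 →ₗ[ℝ] Matrix (Fin n) (Fin n) 𝔽 :=
    { toFun := fun X => ((2 * a + 3 : ℕ) : ℝ) • (X - ((n : ℝ)⁻¹ * ⟪1, X⟫_ℝ) • 1)
      map_add' := fun X Y => by
        rw [inner_add_right]
        module
      map_smul' := fun r X => by
        rw [inner_smul_right, RingHom.id_apply]
        module }
  have h1 := (LinearMap.toContinuousLinearMap L).hasFDerivAt.comp A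
    (hasFDerivAt_pow (2 * (a : ℕ) + 2) A)
  have h2 := h1.hasFDerivWithinAt (s := B n 𝔽) |>.congr
    (fun X hX => gradField_eq hX hn a) (gradField_eq hA hn a)
  exact fderivWithin_apply_of_mem_tangentSpace h2 hv

theorem fderivWithin_gradField_mem (hA : A ∈ B n 𝔽) (hn : 0 < n) (a : Fin ((n - 1) / 2))
    {v : Matrix (Fin n) (Fin n) 𝔽} (hv : v ∈ tangentSpace (B n 𝔽) A) :
    fderivWithin ℝ (gradField n 𝔽 a) (B n 𝔽) A v ∈ tangentSpace (S n 𝔽) A := by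
  obtain ⟨hvh, hvA, hvj⟩ := (mem_tangentSpace_B hA hn).1 hv
  have hh := hA.1.1
  have hn' : (n : ℝ) ≠ 0 := by exact_mod_cast hn.ne'
  rw [fderivWithin_gradField hA hn a hv, mem_tangentSpace_S hA.1]
  refine ⟨?_, ?_, ?_⟩
  · have h1 : powDeriv (2 * (a : ℕ) + 2) A v ∈ hermitianSpace n 𝔽 := isHermitian_powDeriv hh hvh _
    have h2 : (1 : Matrix (Fin n) (Fin n) 𝔽) ∈ hermitianSpace n 𝔽 := Matrix.isHermitian_one
    exact Submodule.smul_mem _ _ (Submodule.sub_mem _ h1 (Submodule.smul_mem _ _ h2))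
  · rw [inner_smul_right, inner_sub_right, inner_smul_right, inner_one_one_matrix]
    field_simp
    ring
  · have h1 : ⟪A, powDeriv (2 * (a : ℕ) + 2) A v⟫_ℝ = 0 := by
      rw [← inner_powDeriv_left hh]
      nth_rewrite 2 [← pow_one A]
      rw [powDeriv_pow, real_inner_smul_left,
        show 2 * (a : ℕ) + 2 - 1 + 1 = 2 * (a + 1) by omega, hvj, mul_zero]
    have h2 : ⟪A, 1⟫_ℝ = 0 := by
      rw [real_inner_comm]
      exact (trace_eq_zero_iff hh).1 hA.1.2.1
    rw [inner_smul_right, inner_sub_right, inner_smul_right, h1, h2]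
    ring

/-- The shape operator of the gradient of `f_k`, for `k = 2 * a + 3`, is a multiple of the
tangential part of `powDeriv (k - 1) A`. -/
theorem inner_shapeOperator_gradField (hA : A ∈ B n 𝔽) (hn : 0 < n) (a : Fin ((n - 1) / 2))
    (v w : tangentSpace (B n 𝔽) A) :
    ⟪shapeOperator (S n 𝔽) (B n 𝔽) (gradField n 𝔽 a) A v, w⟫_ℝ =
      -((2 * a + 3 : ℕ) : ℝ) * ⟪powDeriv (2 * a + 2) A v, (w : Matrix (Fin n) (Fin n) 𝔽)⟫_ℝ := by
  have hw : ⟪1, (w : Matrix (Fin n) (Fin n) 𝔽)⟫_ℝ = 0 := by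
    simpa using ((mem_tangentSpace_B hA hn).1 w.2).2.2 0
  refine (inner_shapeOperator B_subset_S _ v w).trans
    ((congrArg (fun x => -⟪x, (w : Matrix (Fin n) (Fin n) 𝔽)⟫_ℝ)
      (fderivWithin_gradField hA hn a v.2)).trans ?_)
  rw [real_inner_smul_left, inner_sub_left, real_inner_smul_left, hw]
  ring

theorem isSymmetric_shapeOperator_gradField (hA : A ∈ B n 𝔽) (hn : 0 < n)
    (a : Fin ((n - 1) / 2)) :
    (shapeOperator (S n 𝔽) (B n 𝔽) (gradField n 𝔽 a) A).IsSymmetric := by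
  intro v w
  rw [real_inner_comm _ v, inner_shapeOperator_gradField hA hn, inner_shapeOperator_gradField hA hn,
    inner_powDeriv_left hA.1.1, real_inner_comm]

/-- If `v` is tangent to `B` at `A`, then subtracting its component in the span of the odd powers of
`A` yields a tangent vector `u` that is orthogonal to all powers of `A`. The operators
`powDeriv (2 * k) A` preserve the space of these, and they map the component that was subtracted to
even powers of `A`, which are normal to `B`; so the shape operators act on `v` as they act on `u`,
by multiples of `powDeriv (2 * k) A`. -/
theorem exists_orthogonal_to_powers (hA : A ∈ B n 𝔽) (hn : 0 < n)
    {v : Matrix (Fin n) (Fin n) 𝔽} (hv : v ∈ tangentSpace (B n 𝔽) A) :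
    ∃ u : Matrix (Fin n) (Fin n) 𝔽, u.IsHermitian ∧ (∀ i, ⟪A ^ i, u⟫_ℝ = 0) ∧
      ∀ k, ∀ w ∈ tangentSpace (B n 𝔽) A,
        ⟪powDeriv (2 * k) A v, w⟫_ℝ = ⟪powDeriv (2 * k) A u, w⟫_ℝ := by
  obtain ⟨hvh, hvA, hvj⟩ := (mem_tangentSpace_B hA hn).1 hv
  have hh := hA.1.1
  set O : Submodule ℝ (Matrix (Fin n) (Fin n) 𝔽) :=
    Submodule.span ℝ (Set.range fun j : ℕ => A ^ (2 * j + 1)) with hO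
  set c := O.starProjection v with hc
  have hcO : c ∈ O := Submodule.starProjection_apply_mem _ _
  have hOh : O ≤ hermitianSpace n 𝔽 := Submodule.span_le.2 (by
    rintro _ ⟨j, rfl⟩
    exact hh.pow _)
  have hOe : ∀ j, ∀ x ∈ O, ⟪A ^ (2 * j), x⟫_ℝ = 0 := by
    intro j x hx
    refine Submodule.span_induction ?_ (by simp) (fun a b _ _ ha hb => by
      rw [inner_add_right, ha, hb, add_zero]) (fun r a _ ha => by
      rw [inner_smul_right, ha, mul_zero]) hx
    rintro _ ⟨i, rfl⟩
    rw [inner_pow_pow hh]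
    exact inner_one_odd_pow hA ⟨j + i, by ring⟩
  refine ⟨v - c, Submodule.sub_mem (hermitianSpace n 𝔽) hvh (hOh hcO), fun i => ?_,
    fun k w hw => ?_⟩
  · rcases Nat.even_or_odd' i with ⟨j, rfl | rfl⟩
    · rw [inner_sub_right, hvj, hOe j c hcO, sub_zero]
    · exact Submodule.sub_starProjection_mem_orthogonal v _ (Submodule.subset_span ⟨j, rfl⟩)
  · have hwj := ((mem_tangentSpace_B hA hn).1 hw).2.2
    have h1 : ⟪powDeriv (2 * k) A c, w⟫_ℝ = 0 := by
      refine Submodule.span_induction (p := fun x _ => ⟪powDeriv (2 * k) A x, w⟫_ℝ = 0) ?_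
        (by simp) (fun a b _ _ ha hb => by rw [map_add, inner_add_left, ha, hb, add_zero])
        (fun r a _ ha => by rw [map_smul, real_inner_smul_left, ha, mul_zero]) hcO
      rintro _ ⟨i, rfl⟩
      rw [powDeriv_pow, real_inner_smul_left]
      rcases k with _ | k
      · simp
      · rw [show 2 * (k + 1) - 1 + (2 * i + 1) = 2 * (k + 1 + i) by omega, hwj, mul_zero]
    rw [map_sub, inner_sub_left, h1, sub_zero]

theorem mem_tangentSpace_B_of_orthogonal (hA : A ∈ B n 𝔽) (hn : 0 < n)
    {u : Matrix (Fin n) (Fin n) 𝔽} (huh : u.IsHermitian) (hu : ∀ i, ⟪A ^ i, u⟫_ℝ = 0) :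
    u ∈ tangentSpace (B n 𝔽) A :=
  (mem_tangentSpace_B hA hn).2 ⟨huh, by simpa using hu 1, fun j => hu _⟩

theorem commute_shapeOperator_gradField (hA : A ∈ B n 𝔽) (hn : 0 < n)
    (a b : Fin ((n - 1) / 2)) :
    Commute (shapeOperator (S n 𝔽) (B n 𝔽) (gradField n 𝔽 a) A)
      (shapeOperator (S n 𝔽) (B n 𝔽) (gradField n 𝔽 b) A) := by
  have hh := hA.1.1
  refine LinearMap.ext fun v => ?_
  obtain ⟨u, huh, hu, huv⟩ := exists_orthogonal_to_powers hA hn v.2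
  have hP : ∀ {y : Matrix (Fin n) (Fin n) 𝔽} (hyh : y.IsHermitian) (hy : ∀ i, ⟪A ^ i, y⟫_ℝ = 0)
      (r : ℝ) (k : ℕ), (r • powDeriv k A y).IsHermitian ∧
        ∀ i, ⟪A ^ i, r • powDeriv k A y⟫_ℝ = 0 := fun hyh hy r k =>
    ⟨Submodule.smul_mem (hermitianSpace n 𝔽) r (isHermitian_powDeriv hh hyh k), fun i => by
      rw [inner_smul_right, inner_pow_powDeriv hh hy, mul_zero]⟩
  -- an operator acts on `v` as on `u`
  have key : ∀ (a : Fin ((n - 1) / 2)) (x : tangentSpace (B n 𝔽) A)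
      (y : Matrix (Fin n) (Fin n) 𝔽) (hyh : y.IsHermitian) (hy : ∀ i, ⟪A ^ i, y⟫_ℝ = 0)
      (hxy : ∀ k, ∀ w ∈ tangentSpace (B n 𝔽) A,
        ⟪powDeriv (2 * k) A x, w⟫_ℝ = ⟪powDeriv (2 * k) A y, w⟫_ℝ),
      (shapeOperator (S n 𝔽) (B n 𝔽) (gradField n 𝔽 a) A x : Matrix (Fin n) (Fin n) 𝔽) =
        (-((2 * a + 3 : ℕ) : ℝ)) • powDeriv (2 * a + 2) A y := by
    intro a x y hyh hy hxy
    have hmem := mem_tangentSpace_B_of_orthogonal hA hn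
      (hP hyh hy (-((2 * a + 3 : ℕ) : ℝ)) (2 * a + 2)).1 (hP hyh hy _ _).2
    refine congrArg Subtype.val (a₂ := (⟨_, hmem⟩ : tangentSpace (B n 𝔽) A))
      (ext_inner_right ℝ fun w => ?_)
    rw [inner_shapeOperator_gradField hA hn, Submodule.coe_inner, real_inner_smul_left,
      show 2 * (a : ℕ) + 2 = 2 * (a + 1) by ring, hxy _ _ w.2]
  have h2 : ∀ a b : Fin ((n - 1) / 2),
      (shapeOperator (S n 𝔽) (B n 𝔽) (gradField n 𝔽 a) A
        (shapeOperator (S n 𝔽) (B n 𝔽) (gradField n 𝔽 b) A v) : Matrix (Fin n) (Fin n) 𝔽) =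
      (-((2 * a + 3 : ℕ) : ℝ)) • (-((2 * b + 3 : ℕ) : ℝ)) •
        powDeriv (2 * a + 2) A (powDeriv (2 * b + 2) A u) := by
    intro a b
    have h3 := key b v u huh hu huv
    rw [key a _ ((-((2 * b + 3 : ℕ) : ℝ)) • powDeriv (2 * b + 2) A u) (hP huh hu _ _).1
      (hP huh hu _ _).2 (fun k w _ => by rw [h3]), map_smul]
  refine Subtype.ext ?_
  change (shapeOperator (S n 𝔽) (B n 𝔽) (gradField n 𝔽 a) A
        (shapeOperator (S n 𝔽) (B n 𝔽) (gradField n 𝔽 b) A v) : Matrix (Fin n) (Fin n) 𝔽) =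
    shapeOperator (S n 𝔽) (B n 𝔽) (gradField n 𝔽 b) A
        (shapeOperator (S n 𝔽) (B n 𝔽) (gradField n 𝔽 a) A v)
  rw [h2, h2, powDeriv_comm, smul_comm]

theorem conj_mem_tangentSpace_B (hA : A ∈ B n 𝔽) (hn : 0 < n)
    {R v : Matrix (Fin n) (Fin n) 𝔽} (hR : R * Rᴴ = 1) (hRA : Rᴴ * A = -(A * Rᴴ))
    (hv : v ∈ tangentSpace (B n 𝔽) A) : Rᴴ * v * R ∈ tangentSpace (B n 𝔽) A := by
  obtain ⟨hvh, hvA, hvj⟩ := (mem_tangentSpace_B hA hn).1 hv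
  have h1 : ∀ k, ⟪A ^ k, Rᴴ * v * R⟫_ℝ = ⟪(-A) ^ k, v⟫_ℝ := fun k => by
    rw [← conj_pow_eq_neg_pow hR hRA, inner_mul_right, inner_mul_left,
      Matrix.conjTranspose_conjTranspose, mul_assoc]
  refine (mem_tangentSpace_B hA hn).2 ⟨?_, ?_, fun j => ?_⟩
  · rw [Matrix.IsHermitian, Matrix.conjTranspose_mul, Matrix.conjTranspose_mul,
      Matrix.conjTranspose_conjTranspose, hvh.eq, mul_assoc]
  · have h2 := h1 1
    rw [pow_one, pow_one, inner_neg_left, hvA, neg_zero] at h2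
    exact h2
  · rw [h1, (even_two_mul j).neg_pow, hvj]

/-- The conjugation by a unitary matrix that maps `A` to `-A` preserves the tangent space of `B` at
`A` and anticommutes with the shape operators. -/
theorem exists_anticommuting_equiv (hA : A ∈ B n 𝔽) (hn : 0 < n) :
    ∃ J : tangentSpace (B n 𝔽) A ≃ₗ[ℝ] tangentSpace (B n 𝔽) A, ∀ a v,
      J (shapeOperator (S n 𝔽) (B n 𝔽) (gradField n 𝔽 a) A v) =
        -shapeOperator (S n 𝔽) (B n 𝔽) (gradField n 𝔽 a) A (J v) := by
  obtain ⟨R, hR, hR', hAR, hRA⟩ := exists_unitary_of_mem_B hA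
  have hmem : ∀ v ∈ tangentSpace (B n 𝔽) A, R * v * Rᴴ ∈ tangentSpace (B n 𝔽) A := by
    intro v hv
    have h1 := conj_mem_tangentSpace_B hA hn (R := Rᴴ) (v := v)
      (by rw [Matrix.conjTranspose_conjTranspose, hR])
      (by rw [Matrix.conjTranspose_conjTranspose, hAR, neg_neg]) hv
    rwa [Matrix.conjTranspose_conjTranspose] at h1
  have hmem' : ∀ v ∈ tangentSpace (B n 𝔽) A, Rᴴ * v * R ∈ tangentSpace (B n 𝔽) A := fun v hv =>
    conj_mem_tangentSpace_B hA hn hR' hRA hv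
  have hinv : ∀ v, Rᴴ * (R * v * Rᴴ) * R = v := fun v => by
    rw [mul_assoc, mul_assoc, hR, mul_one, ← mul_assoc, hR, one_mul]
  have hinv' : ∀ v, R * (Rᴴ * v * R) * Rᴴ = v := fun v => by
    rw [mul_assoc, mul_assoc, hR', mul_one, ← mul_assoc, hR', one_mul]
  let J : tangentSpace (B n 𝔽) A ≃ₗ[ℝ] tangentSpace (B n 𝔽) A :=
    { toFun := fun v => ⟨R * v * Rᴴ, hmem v v.2⟩
      invFun := fun v => ⟨Rᴴ * v * R, hmem' v v.2⟩
      left_inv := fun v => Subtype.ext (hinv v)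
      right_inv := fun v => Subtype.ext (hinv' v)
      map_add' := fun v w => Subtype.ext (by simp [mul_add, add_mul])
      map_smul' := fun r v => Subtype.ext (by simp) }
  have hJ : ∀ v w, ⟪J v, w⟫_ℝ = ⟪v, J.symm w⟫_ℝ := fun v w => by
    change ⟪R * (v : Matrix (Fin n) (Fin n) 𝔽) * Rᴴ, (w : Matrix (Fin n) (Fin n) 𝔽)⟫_ℝ =
      ⟪(v : Matrix (Fin n) (Fin n) 𝔽), Rᴴ * (w : Matrix (Fin n) (Fin n) 𝔽) * R⟫_ℝ
    rw [inner_mul_right, inner_mul_left, Matrix.conjTranspose_conjTranspose, mul_assoc]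
  refine ⟨J, fun a v => ext_inner_right ℝ fun w => ?_⟩
  rw [hJ, inner_neg_left, inner_shapeOperator_gradField hA hn, inner_shapeOperator_gradField hA hn]
  change _ * ⟪_, Rᴴ * (w : Matrix (Fin n) (Fin n) 𝔽) * R⟫_ℝ = -(_ * ⟪powDeriv _ A (R * v * Rᴴ), _⟫_ℝ)
  rw [show 2 * (a : ℕ) + 2 = 2 * (a + 1) by ring, powDeriv_conj_of_anticommute hAR hRA,
    inner_neg_left, inner_mul_right, inner_mul_left, Matrix.conjTranspose_conjTranspose, mul_assoc Rᴴ]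
  ring

/-- The geometry of `B` over an algebra with the common properties of `ℝ`, `ℂ` and `ℍ`. -/
theorem austere_flat_of_isEuclideanStarRing (hn : 3 ≤ n) :
    B n 𝔽 ⊆ S n 𝔽 ∧
      IsSubmanifold (B n 𝔽) (dimE n 𝔽 - (n - 1) / 2 - 1) ∧
      IsAustere (S n 𝔽) (B n 𝔽) ∧
      HasFlatNormalBundle (S n 𝔽) (B n 𝔽) ∧
      IsNormalFrame (S n 𝔽) (B n 𝔽) (gradField n 𝔽) ∧
      ∀ A ∈ B n 𝔽, SimultaneouslyDiagonalizableSymmetric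
        (fun a => shapeOperator (S n 𝔽) (B n 𝔽) (gradField n 𝔽 a) A) := by
  have hn' : 0 < n := by omega
  have hframe : IsNormalFrame (S n 𝔽) (B n 𝔽) (gradField n 𝔽) := isNormalFrame_gradField hn'
  refine ⟨B_subset_S, isSubmanifold_B hn, ?_, ?_, hframe, fun A hA => ?_⟩
  · exact isAustere_of_anticommute B_subset_S hframe
      (fun A hA a => isSymmetric_shapeOperator_gradField hA hn' a)
      fun A hA => exists_anticommuting_equiv hA hn'
  · have h1 := hasFlatNormalBundle_of_commute (N := S n 𝔽) (ν := gradField n 𝔽)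
      ((contDiff_sphereMap (tracelessSpace n 𝔽)).prodMk (contDiff_Φ (n := n) (𝔽 := 𝔽)))
    rw [← B_eq_regularZeros] at h1
    exact h1 B_subset_S hframe (fun A hA v hv a => fderivWithin_gradField_mem hA hn' a hv)
      (fun A hA a => isSymmetric_shapeOperator_gradField hA hn' a)
      fun A hA a b => commute_shapeOperator_gradField hA hn' a b
  · obtain ⟨J, hJ⟩ := exists_anticommuting_equiv hA hn'
    exact simultaneouslyDiagonalizableSymmetric_of_anticommute
      (fun a => isSymmetric_shapeOperator_gradField hA hn' a)
      (fun a b => commute_shapeOperator_gradField hA hn' a b) J hJ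

end ShapeOperators

end HermitianMatrices

open SubmanifoldGeometry HermitianMatrices in
theorem mainTheorem1 (n : ℕ) (hn : 3 ≤ n) :
    (B n ℝ ⊆ S n ℝ ∧
      IsSubmanifold (B n ℝ) (dimE n ℝ - (n - 1) / 2 - 1) ∧
      IsAustere (S n ℝ) (B n ℝ) ∧
      HasFlatNormalBundle (S n ℝ) (B n ℝ) ∧
      IsNormalFrame (S n ℝ) (B n ℝ) (gradField n ℝ) ∧
      ∀ A ∈ B n ℝ, SimultaneouslyDiagonalizableSymmetric
        (fun a => shapeOperator (S n ℝ) (B n ℝ) (gradField n ℝ a) A)) ∧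
    (B n ℂ ⊆ S n ℂ ∧
      IsSubmanifold (B n ℂ) (dimE n ℂ - (n - 1) / 2 - 1) ∧
      IsAustere (S n ℂ) (B n ℂ) ∧
      HasFlatNormalBundle (S n ℂ) (B n ℂ) ∧
      IsNormalFrame (S n ℂ) (B n ℂ) (gradField n ℂ) ∧
      ∀ A ∈ B n ℂ, SimultaneouslyDiagonalizableSymmetric
        (fun a => shapeOperator (S n ℂ) (B n ℂ) (gradField n ℂ a) A)) ∧
    (B n ℍ[ℝ] ⊆ S n ℍ[ℝ] ∧
      IsSubmanifold (B n ℍ[ℝ]) (dimE n ℍ[ℝ] - (n - 1) / 2 - 1) ∧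
      IsAustere (S n ℍ[ℝ]) (B n ℍ[ℝ]) ∧
      HasFlatNormalBundle (S n ℍ[ℝ]) (B n ℍ[ℝ]) ∧
      IsNormalFrame (S n ℍ[ℝ]) (B n ℍ[ℝ]) (gradField n ℍ[ℝ]) ∧
      ∀ A ∈ B n ℍ[ℝ], SimultaneouslyDiagonalizableSymmetric
        (fun a => shapeOperator (S n ℍ[ℝ]) (B n ℍ[ℝ]) (gradField n ℍ[ℝ] a) A)) :=
  ⟨austere_flat_of_isEuclideanStarRing hn, austere_flat_of_isEuclideanStarRing hn,
    austere_flat_of_isEuclideanStarRing hn⟩
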